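/- Write $u=(u_0,u_1,u_2,u_3)^T\in\mathbb R^4$ and let $\langle u,w\rangle=u^TJw=u_1w_1+u_2w_2-u_0w_3-u_3w_0$ be the Lorentzian inner product, with matrix $J$. Let $O(3,1)=\{\Theta\in GL(4,\mathbb R):\Theta^TJ\Theta=J\}$, $SO(3,1)=\{\Theta\in O(3,1):\det\Theta=1\}$, acting linearly on the light cone $C_L=\{u:\langle u,u\rangle=0\}$. Consider smooth parametrized curves $u(x)$ in $C_L$, defined on open sets of parameters, that are star-shaped (non-radial: $u'$ is never a multiple of $u$) and lie in the domain $u_3\neq0$; then $\langle u',u'\rangle>0$ and we put $\|u'\|_J=\langle u',u'\rangle^{1/2}$ and, for any $w$, $\|w\|_J^2=\langle w,w\rangle$. For $p,q,r\in\mathbb R^4$ let $\det(p,q,r)$ be the $3\times3$ determinant of their coordinates with indices $1,2,3$. Group elements are regarded as acting wherever the image still satisfies $u_3\ne0$, and the prolonged action on jets is $\Theta\cdot(x,u,u',\dots,u^{(m)})=(x,\Theta u,\Theta u',\dots,\Theta u^{(m)})$. Let $\hat u=(u_1,u_2)^T$ and $$\rho_L=\begin{pmatrix}1&0&0\\ \xi&I&0\\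 \tfrac12\|\xi\|^2&\xi^T&1\end{pmatrix}\begin{pmatrix}u_3&0&0\\0&A&0\\0&0&u_3^{-1}\end{pmatrix}\begin{pmatrix}1&v^T&\tfrac12\|v\|^2\\0&I&v\\0&0&1\end{pmatrix},\qquad v=-\frac{\hat u}{u_3},$$ $$A=\frac1{u_3\|u'\|_J}\begin{pmatrix}u_3u_1'-u_1u_3'&u_3u_2'-u_2u_3'\\ u_2u_3'-u_3u_2'&u_3u_1'-u_1u_3'\end{pmatrix},\qquad \xi=\begin{pmatrix}-\dfrac{u_3'}{u_3\|u'\|_J}\\[2mm] -\dfrac{\det(u,u',u'')}{u_3\|u'\|_J^3}\end{pmatrix}.$$ **Theorem.** (i) On second jets of such curves, $g=\rho_L$ is the unique element of $SO(3,1)$ satisfying the normalization equations $gu=(0,0,0,1)^T$, $gu'=(0,\|u'\|_J,0,0)^T$ and third entry of $gu''$ equal to $0$. The map $\rho_L$ is a right moving frame, i.e. $\rho_L(\Theta\cdot j)=\rho_L(j)\Theta^{-1}$ for $\Theta\in SO(3,1)$ and second jets $j$. (ii) Along every such curve $\rho_L$ is differentiable and its right Maurer–Cartan matrix is $$K_L=(\rho_L)_x\rho_L^{-1}=\begin{pmatrix}0&-k_0&0&0\\-k_1&0&0&-k_0\\-k_2&0&0&0\\0&-k_1&-k_2&0\end{pmatrix},$$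 where $k_0=\|u'\|_J$, $$k_1=\frac{-\|u''\|_J^2\|u'\|_J^2+\langle u',u''\rangle^2}{2\|u'\|_J^5},\qquad k_2=\frac{\det(u,u',u''')}{u_3\|u'\|_J^3}-3\,\frac{\langle u',u''\rangle}{u_3\|u'\|_J^5}\det(u,u',u'').$$ (iii) $k_0$ and $k_1$ are invariant under the prolonged action of $O(3,1)$, $k_2$ is invariant under that of $SO(3,1)$, and $k_2(\Theta\cdot j)=\det(\Theta)\,k_2(j)$ for all $\Theta\in O(3,1)$ and third jets $j$. (iv) $k_0,k_1,k_2$ and their derivatives functionally generate all differential invariants: for every $m\ge0$ and every real function $I$ of $m$-jets of such curves that is invariant under the prolonged action of $SO(3,1)$ (in particular, for every $O(3,1)$-invariant one) there is a function $F$ with $$I(x,u,u',\dots,u^{(m)})=F\bigl(x,(k_i^{(r)})_{i=0,1,2;\,0\le r\le m}\bigr)$$ along every such curve, and $F$ is smooth at every point $(x,(k_i^{(r)}(x)))$ coming from a curve at whose $m$-jet $I$ is smooth. -/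

import Mathlib

open scoped Matrix ContDiff

noncomputable section

namespace LightCone

/-- Points of Lorentzian `ℝ⁴`, with coordinates `(u₀, u₁, u₂, u₃)`. -/
abbrev V : Type := Fin 4 → ℝ

abbrev Mat4 : Type := Matrix (Fin 4) (Fin 4) ℝ

/-- The matrix of the Minkowski form. -/
def J : Mat4 :=
  !![0, 0, 0, -1;
     0, 1, 0, 0;
     0, 0, 1, 0;
     -1, 0, 0, 0]

/-- The Minkowski form `⟨v, w⟩ = vᵀ J w`. -/
def ip (v w : V) : ℝ := v ⬝ᵥ (J *ᵥ w)

/-- The length `‖v‖_J`, used for vectors with `⟨v, v⟩ ≥ 0`. -/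
def normJ (v : V) : ℝ := Real.sqrt (ip v v)

/-- The light cone. -/
def cone : Set V := {u | ip u u = 0}

/-- The Lorentz group `O(3,1)`; the defining equation forces `Θ` to be invertible. -/
def O31 : Set Mat4 := {Θ | Θᵀ * J * Θ = J}

/-- The special Lorentz group `SO(3,1)`. -/
def SO31 : Set Mat4 := {Θ | Θ ∈ O31 ∧ Θ.det = 1}

/-- A smooth star-shaped (non-radial) curve in the light cone, defined on the open set `s` of
parameters and contained in the coordinate domain `u₃ ≠ 0`: the velocity is never in the radial
direction. -/
structure IsStarShaped (u : ℝ → V) (s : Set ℝ) : Prop where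
  isOpen : IsOpen s
  smooth : ContDiffOn ℝ ∞ u s
  mem_cone : ∀ x ∈ s, u x ∈ cone
  coord_ne_zero : ∀ x ∈ s, u x 3 ≠ 0
  nonradial : ∀ x ∈ s, deriv u x ∉ Submodule.span ℝ {u x}

/-- Coordinates `(x, u, u', …, u⁽ᵐ⁾)` of `m`-jets of curves in `ℝ⁴`. -/
abbrev Jet (m : ℕ) : Type := ℝ × (Fin (m + 1) → V)

/-- The `m`-jet of the curve `u` at `x`. -/
def jet (m : ℕ) (u : ℝ → V) (x : ℝ) : Jet m := (x, fun r => iteratedDeriv (r : ℕ) u x)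

/-- The `m`-jets of star-shaped curves in the light cone. -/
def coneJets (m : ℕ) : Set (Jet m) :=
  {j | ∃ (u : ℝ → V) (s : Set ℝ) (x : ℝ), IsStarShaped u s ∧ x ∈ s ∧ jet m u x = j}

/-- The prolonged action on jets. The action on the cone is linear, so that
`(Θ u)⁽ʳ⁾ = Θ u⁽ʳ⁾`, and the parameter is not acted on. -/
def act {m : ℕ} (Θ : Mat4) (j : Jet m) : Jet m := (j.1, fun r => Θ *ᵥ j.2 r)

/-- `I` is a differential invariant of order at most `m` of star-shaped curves in the cone under
the linear action of the group of matrices `G`. -/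
def IsDifferentialInvariant (G : Set Mat4) (m : ℕ) (I : Jet m → ℝ) : Prop :=
  ∀ Θ ∈ G, ∀ j ∈ coneJets m, act Θ j ∈ coneJets m → I (act Θ j) = I j

/-- `ρ` is a right moving frame with values in the group of matrices `G`: it is equivariant with
respect to the prolonged action of `G` and the right inverse action of `G` on itself. -/
def IsRightMovingFrame (G : Set Mat4) (m : ℕ) (ρ : Jet m → Mat4) : Prop :=
  (∀ j ∈ coneJets m, ρ j ∈ G) ∧
  ∀ Θ ∈ G, ∀ j ∈ coneJets m, act Θ j ∈ coneJets m → ρ (act Θ j) = ρ j * Θ⁻¹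

/-- The right Maurer–Cartan matrix `ρₓ ρ⁻¹` at `x` of a curve `ρ` of matrices. -/
def rightMaurerCartan (ρ : ℝ → Mat4) (x : ℝ) : Mat4 :=
  (Matrix.of fun a b => deriv (fun y => ρ y a b) x) * (ρ x)⁻¹

/-- The determinant of the last three coordinates `(u₁, u₂, u₃)` of three vectors. -/
def det3 (p q r : V) : ℝ :=
  Matrix.det !![p 1, p 2, p 3;
                q 1, q 2, q 3;
                r 1, r 2, r 3]

/-- The lower triangular factor, with `ξ = (ξ₁, ξ₂)`. -/
def gPos (ξ₁ ξ₂ : ℝ) : Mat4 :=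
  !![1, 0, 0, 0;
     ξ₁, 1, 0, 0;
     ξ₂, 0, 1, 0;
     (ξ₁ ^ 2 + ξ₂ ^ 2) / 2, ξ₁, ξ₂, 1]

/-- The block diagonal factor, with blocks `α`, `A` and `α⁻¹`. -/
def gZero (α : ℝ) (A : Matrix (Fin 2) (Fin 2) ℝ) : Mat4 :=
  !![α, 0, 0, 0;
     0, A 0 0, A 0 1, 0;
     0, A 1 0, A 1 1, 0;
     0, 0, 0, α⁻¹]

/-- The upper triangular factor, with `v = (v₁, v₂)`. -/
def gNeg (v₁ v₂ : ℝ) : Mat4 :=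
  !![1, v₁, v₂, (v₁ ^ 2 + v₂ ^ 2) / 2;
     0, 1, 0, v₁;
     0, 0, 1, v₂;
     0, 0, 0, 1]

/-- The rotation block `A` of the frame, as a function of `p = u` and `q = u'`. -/
def frameA (p q : V) : Matrix (Fin 2) (Fin 2) ℝ :=
  (1 / (p 3 * normJ q)) •
    !![p 3 * q 1 - p 1 * q 3, p 3 * q 2 - p 2 * q 3;
       p 2 * q 3 - p 3 * q 2, p 3 * q 1 - p 1 * q 3]

/-- The frame `ρ_L`, a function of the second jet `(x, u, u', u'')`. -/
def coneFrame (j : Jet 2) : Mat4 :=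
  gPos (-(j.2 1 3) / (j.2 0 3 * normJ (j.2 1)))
      (-(det3 (j.2 0) (j.2 1) (j.2 2)) / (j.2 0 3 * normJ (j.2 1) ^ 3)) *
    gZero (j.2 0 3) (frameA (j.2 0) (j.2 1)) *
    gNeg (-(j.2 0 1) / j.2 0 3) (-(j.2 0 2) / j.2 0 3)

/-- `k₀ = ‖u'‖_J`. -/
def k0 (j : Jet 3) : ℝ := normJ (j.2 1)

/-- `k₁ = (⟨u', u''⟩² - ⟨u'', u''⟩ ‖u'‖_J²) / (2 ‖u'‖_J⁵)`. -/
def k1 (j : Jet 3) : ℝ :=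
  (-(ip (j.2 2) (j.2 2)) * normJ (j.2 1) ^ 2 + ip (j.2 1) (j.2 2) ^ 2) / (2 * normJ (j.2 1) ^ 5)

/-- `k₂ = det(u, u', u''') / (u₃ ‖u'‖_J³) - 3 ⟨u', u''⟩ det(u, u', u'') / (u₃ ‖u'‖_J⁵)`. -/
def k2 (j : Jet 3) : ℝ :=
  1 / (j.2 0 3 * normJ (j.2 1) ^ 3) * det3 (j.2 0) (j.2 1) (j.2 3)
    - 3 * (ip (j.2 1) (j.2 2) / (j.2 0 3 * normJ (j.2 1) ^ 5)) * det3 (j.2 0) (j.2 1) (j.2 2)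

/-- The matrix `K_L` with entries `k₀, k₁, k₂`. -/
def KL (k₀ k₁ k₂ : ℝ) : Mat4 :=
  !![0, -k₀, 0, 0;
     -k₁, 0, 0, -k₀;
     -k₂, 0, 0, 0;
     0, -k₁, -k₂, 0]

/-- The three generating invariants as a family. -/
def gen : Fin 3 → Jet 3 → ℝ := ![k0, k1, k2]

/-- The parameter `x` together with the derivatives of orders `0, …, m` of `k₀, k₁, k₂` along the
curve `u` at `x`. -/
def genJet (m : ℕ) (u : ℝ → V) (x : ℝ) : ℝ × (Fin 3 → Fin (m + 1) → ℝ) :=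
  (x, fun i r => iteratedDeriv (r : ℕ) (fun y => gen i (jet 3 u y)) x)

end LightCone

end

noncomputable section

namespace LightCone

/-! The proof is Cartan's method of moving frames. Differentiating `⟨u,u⟩ = 0` gives `⟨u,u'⟩ = 0`
and `⟨u,u''⟩ = -⟨u',u'⟩`, and a non-radial vector tangent to the cone has positive square. So only
the identity in SO(3,1) preserves normalized second jets (`eq_one_of_fixes`), and the normalization
equations have at most one solution; a direct computation shows that `ρ_L` is one. Equivariance
follows from uniqueness: `ρ(j)Θ⁻¹` solves the equations at `Θj`, or does so after a reflection when
`det Θ = -1`, which is where the sign of `k₂` comes from.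

The Maurer–Cartan matrix `K` is skew for the form because `ρ` preserves it. Differentiating the
normalization equations by `(ρu⁽ʳ⁾)' = Kρu⁽ʳ⁾ + ρu⁽ʳ⁺¹⁾` determines the remaining entries.

Read as `ρu⁽ʳ⁺¹⁾ = (ρu⁽ʳ⁾)' - Kρu⁽ʳ⁾` with `ρu = e₃`, the same relation makes the normalized jet
`ρ·j` a polynomial `Φ` in the derivatives of `k₀, k₁, k₂` (`iteratedDeriv_frame_mulVec`). Hence an
invariant satisfies `I(j) = I(ρ·j)`, and `F = I ∘ Φ`. Smoothness of `I` is known only relative to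
jets of cone curves, so `Φ` must take values there near the point in question. It does whenever `k₀
≠ 0`: solving `ρₓ = Kρ` with polynomial coefficients produces a curve with the prescribed jet
(`frenetJet_mem_coneJets`). -/

/-! ### The Lorentz form and its group -/

theorem ip_eq (v w : V) : ip v w = v 1 * w 1 + v 2 * w 2 - v 0 * w 3 - v 3 * w 0 := by
  simp [ip, J, dotProduct, Matrix.mulVec, Fin.sum_univ_four]
  ring

theorem ip_comm (v w : V) : ip v w = ip w v := by
  simp only [ip_eq]; ring

theorem det3_eq (p q r : V) : det3 p q r =
    p 1 * q 2 * r 3 - p 1 * q 3 * r 2 - p 2 * q 1 * r 3 + p 2 * q 3 * r 1 + p 3 * q 1 * r 2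
      - p 3 * q 2 * r 1 := by
  simp [det3, Matrix.det_fin_three]

theorem J_mul_J : J * J = 1 := by
  ext i j
  fin_cases i <;> fin_cases j <;> simp [J, Matrix.mul_apply, Fin.sum_univ_four]

theorem ip_mulVec {Θ : Mat4} (h : Θ ∈ O31) (v w : V) : ip (Θ *ᵥ v) (Θ *ᵥ w) = ip v w := by
  have h' : Θᵀ * J * Θ = J := h
  have e : ip v w = v ⬝ᵥ ((Θᵀ * J * Θ) *ᵥ w) := by rw [h', ip]
  rw [e, ip, ← Matrix.mulVec_mulVec, ← Matrix.mulVec_mulVec, Matrix.dotProduct_mulVec v,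
    Matrix.vecMul_transpose]

theorem normJ_mulVec {Θ : Mat4} (h : Θ ∈ O31) (v : V) : normJ (Θ *ᵥ v) = normJ v := by
  rw [normJ, ip_mulVec h, normJ]

theorem mul_mem_O31 {Θ Φ : Mat4} (h : Θ ∈ O31) (h' : Φ ∈ O31) : Θ * Φ ∈ O31 := by
  change (Θ * Φ)ᵀ * J * (Θ * Φ) = J
  have h : Θᵀ * J * Θ = J := h
  have h' : Φᵀ * J * Φ = J := h'
  calc (Θ * Φ)ᵀ * J * (Θ * Φ) = Φᵀ * (Θᵀ * J * Θ) * Φ := by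
        simp only [Matrix.transpose_mul, Matrix.mul_assoc]
    _ = J := by rw [h, h']

theorem det_mul_self_of_mem_O31 {Θ : Mat4} (h : Θ ∈ O31) : Θ.det * Θ.det = 1 := by
  have h : Θᵀ * J * Θ = J := h
  have hJ : J.det * J.det = 1 := by rw [← Matrix.det_mul, J_mul_J, Matrix.det_one]
  have := congrArg Matrix.det h
  rw [Matrix.det_mul, Matrix.det_mul, Matrix.det_transpose] at this
  linear_combination J.det * this + (1 - Θ.det * Θ.det) * hJ

theorem isUnit_det_of_mem_O31 {Θ : Mat4} (h : Θ ∈ O31) : IsUnit Θ.det :=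
  IsUnit.of_mul_eq_one _ (det_mul_self_of_mem_O31 h)

theorem inv_mem_O31 {Θ : Mat4} (h : Θ ∈ O31) : Θ⁻¹ ∈ O31 := by
  have hu := isUnit_det_of_mem_O31 h
  have h : Θᵀ * J * Θ = J := h
  change (Θ⁻¹)ᵀ * J * Θ⁻¹ = J
  conv_lhs => rw [← h]
  rw [Matrix.mul_assoc, Matrix.mul_assoc _ Θ, Matrix.mul_nonsing_inv _ hu, Matrix.mul_one,
    ← Matrix.mul_assoc, ← Matrix.transpose_mul, Matrix.mul_nonsing_inv _ hu, Matrix.transpose_one,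
    Matrix.one_mul]

theorem mul_mem_SO31 {Θ Φ : Mat4} (h : Θ ∈ SO31) (h' : Φ ∈ SO31) : Θ * Φ ∈ SO31 :=
  ⟨mul_mem_O31 h.1 h'.1, by rw [Matrix.det_mul, h.2, h'.2, one_mul]⟩

theorem inv_mem_SO31 {Θ : Mat4} (h : Θ ∈ SO31) : Θ⁻¹ ∈ SO31 :=
  ⟨inv_mem_O31 h.1, by rw [Matrix.det_nonsing_inv, h.2, Ring.inverse_one]⟩

/-! ### Tangent vectors of the cone -/

/-- A point of the cone in the coordinate domain with a non-radial tangent vector. -/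
structure IsTangentPair (p q : V) : Prop where
  coord_ne_zero : p 3 ≠ 0
  mem_cone : ip p p = 0
  tangent : ip p q = 0
  pos : 0 < ip q q

namespace IsTangentPair

variable {p q : V}

theorem normJ_pos (h : IsTangentPair p q) : 0 < normJ q := Real.sqrt_pos.2 h.pos

theorem normJ_sq (h : IsTangentPair p q) : normJ q ^ 2 = ip q q := Real.sq_sqrt h.pos.le

/-- The form restricted to the tangent space at `p` is positive semidefinite with radical spanned by
`p`: up to the factor `p₃²` it is a sum of two squares, which both vanish only on radial vectors. -/
theorem of_notMem_span (h3 : p 3 ≠ 0) (hp : ip p p = 0) (hpq : ip p q = 0)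
    (h : q ∉ Submodule.span ℝ {p}) : IsTangentPair p q := by
  refine ⟨h3, hp, hpq, ?_⟩
  have key : p 3 ^ 2 * ip q q = (p 3 * q 1 - p 1 * q 3) ^ 2 + (p 3 * q 2 - p 2 * q 3) ^ 2 := by
    rw [ip_eq] at *
    linear_combination (-q 3 ^ 2) * hp + 2 * p 3 * q 3 * hpq
  by_contra hn
  have hle : p 3 ^ 2 * ip q q ≤ 0 := mul_nonpos_of_nonneg_of_nonpos (sq_nonneg _) (not_lt.1 hn)
  have h1 : p 3 * q 1 - p 1 * q 3 = 0 := by nlinarith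
  have h2 : p 3 * q 2 - p 2 * q 3 = 0 := by nlinarith
  refine h (Submodule.mem_span_singleton.2 ⟨q 3 / p 3, ?_⟩)
  have h0 : p 3 * q 0 - p 0 * q 3 = 0 := by
    rw [ip_eq] at *
    have : p 3 * (p 3 * q 0 - p 0 * q 3) = 0 := by
      linear_combination (-p 3) * hpq + q 3 * hp + p 1 * h1 + p 2 * h2
    exact (mul_eq_zero.1 this).resolve_left h3
  ext i
  fin_cases i <;> simp <;> field_simp <;> linarith

theorem notMem_span (h : IsTangentPair p q) : q ∉ Submodule.span ℝ {p} := by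
  intro hq
  obtain ⟨c, rfl⟩ := Submodule.mem_span_singleton.1 hq
  have h1 := h.pos
  have h2 := h.mem_cone
  have : ip (c • p) (c • p) = c ^ 2 * ip p p := by
    simp only [ip_eq, Pi.smul_apply, smul_eq_mul]
    ring
  rw [this, h2, mul_zero] at h1
  exact h1.false

theorem mulVec (h : IsTangentPair p q) {Θ : Mat4} (hΘ : Θ ∈ O31) (h3 : (Θ *ᵥ p) 3 ≠ 0) :
    IsTangentPair (Θ *ᵥ p) (Θ *ᵥ q) :=
  ⟨h3, by rw [ip_mulVec hΘ, h.mem_cone], by rw [ip_mulVec hΘ, h.tangent],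
    by rw [ip_mulVec hΘ]; exact h.pos⟩

end IsTangentPair

/-! ### Normalization equations and the frame -/

theorem gPos_mem (a b : ℝ) : gPos a b ∈ SO31 := by
  constructor
  · change _ = _
    ext i j
    fin_cases i <;> fin_cases j <;> simp [gPos, J, Matrix.mul_apply, Fin.sum_univ_four]
    ring
  · simp [gPos, Matrix.det_succ_row_zero, Fin.sum_univ_succ, Fin.succAbove]

theorem gNeg_mem (a b : ℝ) : gNeg a b ∈ SO31 := by
  constructor
  · change _ = _
    ext i j
    fin_cases i <;> fin_cases j <;> simp [gNeg, J, Matrix.mul_apply, Fin.sum_univ_four]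
    ring
  · simp [gNeg, Matrix.det_succ_row_zero, Fin.sum_univ_succ, Fin.succAbove]

theorem gZero_mem {α c d : ℝ} (hα : α ≠ 0) (h : c ^ 2 + d ^ 2 = 1) :
    gZero α !![c, d; -d, c] ∈ SO31 := by
  constructor
  · change _ = _
    ext i j
    fin_cases i <;> fin_cases j <;>
      simp [gZero, J, Matrix.mul_apply, Fin.sum_univ_four, hα] <;> linarith
  · simp [gZero, Matrix.det_succ_row_zero, Fin.sum_univ_succ, Fin.succAbove]
    field_simp
    linarith

/-- An element of `SO(3,1)` fixing `e₃` and `e₁` whose third row annihilates `e₀` is the identity. -/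
theorem eq_one_of_fixes {f : Mat4} (hf : f ∈ SO31) (h3 : f *ᵥ ![0, 0, 0, 1] = ![0, 0, 0, 1])
    (h1 : f *ᵥ ![0, 1, 0, 0] = ![0, 1, 0, 0]) (h20 : f 2 0 = 0) : f = 1 := by
  have e (i) := congrFun h3 i
  have e' (i) := congrFun h1 i
  have ho : fᵀ * J * f = J := hf.1
  have o (i j) := congrFun (congrFun ho i) j
  have hd := hf.2
  have a0 := e 0
  have a1 := e 1
  have a2 := e 2
  have a3 := e 3
  have b0 := e' 0
  have b1 := e' 1
  have b2 := e' 2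
  have b3 := e' 3
  simp [Matrix.mulVec, dotProduct, Fin.sum_univ_four] at a0 a1 a2 a3 b0 b1 b2 b3
  have o03 := o 0 3
  have o23 := o 2 3
  have o01 := o 0 1
  have o21 := o 2 1
  have o00 := o 0 0
  have o02 := o 0 2
  have o22 := o 2 2
  simp [J, Matrix.mul_apply, Fin.sum_univ_four, a0, a1, a2, a3, b0, b1, b2, b3, h20]
    at o03 o23 o01 o21 o00 o02 o22
  simp only [o03, o23, o01, o21, mul_zero, zero_mul, mul_one, one_mul] at o00 o02 o22
  have c30 : f 3 0 = 0 := by linarith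
  have c32 : f 3 2 = 0 := by linarith
  -- Orthogonality leaves only the sign of `f 2 2` open; the determinant decides it.
  simp [Matrix.det_succ_row_zero, Fin.sum_univ_succ, Fin.succAbove, a1, a2, a3, b1, b2, b3,
    h20, o03, o01, o21, c30, c32] at hd
  ext i j
  fin_cases i <;> fin_cases j <;> simp [*]

/-- The matrix of a reflection that fixes `e₀`, `e₁`, `e₃`. -/
def refl2 : Mat4 := Matrix.diagonal ![1, 1, -1, 1]

theorem refl2_mem : refl2 ∈ O31 := by
  change _ = _
  ext i j
  fin_cases i <;> fin_cases j <;> simp [refl2, J, Matrix.mul_apply, Fin.sum_univ_four]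

theorem det_refl2 : refl2.det = -1 := by
  simp [refl2, Fin.prod_univ_four]

/-- The normalization equations have at most one solution in `SO(3,1)`. -/
theorem eq_of_normalized {p q r : V} (h : IsTangentPair p q) (hr : ip p r = - ip q q)
    {f g : Mat4} (hf : f ∈ SO31) (hg : g ∈ SO31)
    (f0 : f *ᵥ p = ![0, 0, 0, 1]) (g0 : g *ᵥ p = ![0, 0, 0, 1])
    (f1 : f *ᵥ q = ![0, normJ q, 0, 0]) (g1 : g *ᵥ q = ![0, normJ q, 0, 0])
    (f2 : (f *ᵥ r) 2 = 0) (g2 : (g *ᵥ r) 2 = 0) : f = g := by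
  have hu := isUnit_det_of_mem_O31 hg.1
  have hfg (z : V) : (f * g⁻¹) *ᵥ (g *ᵥ z) = f *ᵥ z := by
    rw [Matrix.mulVec_mulVec, Matrix.mul_assoc, Matrix.nonsing_inv_mul _ hu, Matrix.mul_one]
  have hk := h.normJ_pos
  have e3 : (f * g⁻¹) *ᵥ ![0, 0, 0, 1] = ![0, 0, 0, 1] := by rw [← g0, hfg, f0, g0]
  have e1 : (f * g⁻¹) *ᵥ ![0, 1, 0, 0] = ![0, 1, 0, 0] := by
    have hq : (![0, 1, 0, 0] : V) = (normJ q)⁻¹ • ![0, normJ q, 0, 0] := by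
      ext i
      fin_cases i <;> simp [hk.ne']
    rw [hq, Matrix.mulVec_smul, ← g1, hfg, f1, g1]
  have hm := mul_mem_SO31 hf (inv_mem_SO31 hg)
  have key : f * g⁻¹ = 1 := by
    refine eq_one_of_fixes hm e3 e1 ?_
    -- Pairing with `e₃ = g p` reads off minus the zeroth coordinate. Since it is nonzero for `g r`,
    -- the third row of `f g⁻¹` must annihilate `e₀`.
    have g20 : (g *ᵥ r) 0 = ip q q := by
      have := ip_mulVec hg.1 p r
      rw [g0, hr, ip_eq] at this
      simpa using this
    have := congrFun (hfg r) 2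
    rw [f2] at this
    have c3 := congrFun e3 2
    have c1 := congrFun e1 2
    simp [Matrix.mulVec, dotProduct, Fin.sum_univ_four] at c3 c1
    rw [Matrix.mulVec, dotProduct, Fin.sum_univ_four, g2, c3, c1, g20] at this
    have hpos := h.pos.ne'
    simpa [hpos] using this
  calc f = f * g⁻¹ * g := by
        rw [Matrix.mul_assoc, Matrix.nonsing_inv_mul _ hu, Matrix.mul_one]
    _ = g := by rw [key, Matrix.one_mul]

theorem frameA_mem {p q : V} (h : IsTangentPair p q) : gZero (p 3) (frameA p q) ∈ SO31 := by
  have h3 := h.coord_ne_zero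
  have hk := h.normJ_pos.ne'
  have hs := h.normJ_sq
  have h1 := h.mem_cone
  have h2 := h.tangent
  have e : frameA p q = !![(p 3 * q 1 - p 1 * q 3) / (p 3 * normJ q),
      (p 3 * q 2 - p 2 * q 3) / (p 3 * normJ q);
      -((p 3 * q 2 - p 2 * q 3) / (p 3 * normJ q)),
      (p 3 * q 1 - p 1 * q 3) / (p 3 * normJ q)] := by
    ext i j
    fin_cases i <;> fin_cases j <;> simp [frameA] <;> ring
  rw [e]
  refine gZero_mem h3 ?_
  rw [div_pow, div_pow, ← add_div, div_eq_one_iff_eq (by positivity), mul_pow, hs]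
  rw [ip_eq] at *
  linear_combination (q 3 ^ 2) * h1 - 2 * p 3 * q 3 * h2

theorem coneFrame_mem {j : Jet 2} (h : IsTangentPair (j.2 0) (j.2 1)) : coneFrame j ∈ SO31 :=
  mul_mem_SO31 (mul_mem_SO31 (gPos_mem _ _) (frameA_mem h)) (gNeg_mem _ _)

theorem coneFrame_mulVec_zero {j : Jet 2} (h : IsTangentPair (j.2 0) (j.2 1)) :
    coneFrame j *ᵥ j.2 0 = ![0, 0, 0, 1] := by
  have h3 := h.coord_ne_zero
  have h1 := h.mem_cone
  rw [ip_eq] at h1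
  have e : gNeg (-(j.2 0 1) / j.2 0 3) (-(j.2 0 2) / j.2 0 3) *ᵥ j.2 0 = ![0, 0, 0, j.2 0 3] := by
    ext i
    fin_cases i <;> simp [gNeg, Matrix.mulVec, dotProduct, Fin.sum_univ_four] <;> field_simp
    · linear_combination -h1
    · ring
    · ring
  rw [coneFrame, ← Matrix.mulVec_mulVec, ← Matrix.mulVec_mulVec, e]
  have e' : gZero (j.2 0 3) (frameA (j.2 0) (j.2 1)) *ᵥ ![0, 0, 0, j.2 0 3] = ![0, 0, 0, 1] := by
    ext i
    fin_cases i <;> simp [gZero, Matrix.mulVec, dotProduct, Fin.sum_univ_four, h3]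
  rw [e']
  ext i
  fin_cases i <;> simp [gPos, Matrix.mulVec, dotProduct, Fin.sum_univ_four]

theorem coneFrame_mulVec_one {j : Jet 2} (h : IsTangentPair (j.2 0) (j.2 1)) :
    coneFrame j *ᵥ j.2 1 = ![0, normJ (j.2 1), 0, 0] := by
  have h3 := h.coord_ne_zero
  have hk := h.normJ_pos.ne'
  have hs := h.normJ_sq
  have h1 := h.mem_cone
  have h2 := h.tangent
  rw [ip_eq] at h1 h2 hs
  have e : gNeg (-(j.2 0 1) / j.2 0 3) (-(j.2 0 2) / j.2 0 3) *ᵥ j.2 1 =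
      ![0, (j.2 0 3 * j.2 1 1 - j.2 0 1 * j.2 1 3) / j.2 0 3,
        (j.2 0 3 * j.2 1 2 - j.2 0 2 * j.2 1 3) / j.2 0 3, j.2 1 3] := by
    ext i
    fin_cases i <;> simp [gNeg, Matrix.mulVec, dotProduct, Fin.sum_univ_four] <;> field_simp
    · linear_combination -2 * j.2 0 3 * h2 + j.2 1 3 * h1
    · ring
    · ring
  rw [coneFrame, ← Matrix.mulVec_mulVec, ← Matrix.mulVec_mulVec, e]
  have e' : gZero (j.2 0 3) (frameA (j.2 0) (j.2 1)) *ᵥ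
      ![0, (j.2 0 3 * j.2 1 1 - j.2 0 1 * j.2 1 3) / j.2 0 3,
        (j.2 0 3 * j.2 1 2 - j.2 0 2 * j.2 1 3) / j.2 0 3, j.2 1 3] =
      ![0, normJ (j.2 1), 0, j.2 1 3 / j.2 0 3] := by
    ext i
    fin_cases i <;> simp [gZero, frameA, Matrix.mulVec, dotProduct, Fin.sum_univ_four] <;>
      field_simp
    · linear_combination (-j.2 0 3 ^ 2) * hs + (j.2 1 3 ^ 2) * h1 - 2 * j.2 0 3 * j.2 1 3 * h2
    · ring
  rw [e']
  ext i
  fin_cases i <;> simp [gPos, Matrix.mulVec, dotProduct, Fin.sum_univ_four]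
  field_simp
  ring

/-- The third row of the frame as a functional. At `u''` it confirms the last normalization
equation; at `u'''` it produces `k₂`. -/
theorem coneFrame_mulVec_apply_two {j : Jet 2} (h : IsTangentPair (j.2 0) (j.2 1)) (z : V) :
    (coneFrame j *ᵥ z) 2 = det3 (j.2 0) (j.2 1) z / (j.2 0 3 * normJ (j.2 1)) +
      det3 (j.2 0) (j.2 1) (j.2 2) / (j.2 0 3 * normJ (j.2 1) ^ 3) * ip (j.2 0) z := by
  have h3 := h.coord_ne_zero
  have hk := h.normJ_pos.ne'
  have h1 := h.mem_cone
  rw [ip_eq] at h1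
  have e : ((gZero (j.2 0 3) (frameA (j.2 0) (j.2 1)) *
      gNeg (-(j.2 0 1) / j.2 0 3) (-(j.2 0 2) / j.2 0 3)) *ᵥ z) 2 =
      det3 (j.2 0) (j.2 1) z / (j.2 0 3 * normJ (j.2 1)) := by
    rw [← Matrix.mulVec_mulVec, det3_eq]
    simp [gZero, gNeg, frameA, Matrix.mulVec, dotProduct, Fin.sum_univ_four]
    field_simp
    ring
  have e0 : ((gZero (j.2 0 3) (frameA (j.2 0) (j.2 1)) *
      gNeg (-(j.2 0 1) / j.2 0 3) (-(j.2 0 2) / j.2 0 3)) *ᵥ z) 0 = - ip (j.2 0) z := by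
    rw [← Matrix.mulVec_mulVec, ip_eq]
    simp [gZero, gNeg, frameA, Matrix.mulVec, dotProduct, Fin.sum_univ_four]
    field_simp
    linear_combination z 3 * h1
  rw [coneFrame, Matrix.mul_assoc, ← Matrix.mulVec_mulVec]
  generalize (gZero (j.2 0 3) (frameA (j.2 0) (j.2 1)) *
      gNeg (-(j.2 0 1) / j.2 0 3) (-(j.2 0 2) / j.2 0 3)) *ᵥ z = w at *
  simp [gPos, Matrix.mulVec, dotProduct, Fin.sum_univ_four, e, e0]
  ring

theorem coneFrame_mulVec_two {j : Jet 2} (h : IsTangentPair (j.2 0) (j.2 1))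
    (hr : ip (j.2 0) (j.2 2) = - ip (j.2 1) (j.2 1)) : (coneFrame j *ᵥ j.2 2) 2 = 0 := by
  have h3 := h.coord_ne_zero
  have hk := h.normJ_pos.ne'
  rw [coneFrame_mulVec_apply_two h, hr, ← h.normJ_sq]
  field_simp
  ring

theorem normalized_iff {j : Jet 2} (h : IsTangentPair (j.2 0) (j.2 1))
    (hr : ip (j.2 0) (j.2 2) = - ip (j.2 1) (j.2 1)) (g : Mat4) :
    (g ∈ SO31 ∧ g *ᵥ j.2 0 = ![0, 0, 0, 1] ∧ g *ᵥ j.2 1 = ![0, normJ (j.2 1), 0, 0] ∧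
      (g *ᵥ j.2 2) 2 = 0) ↔ g = coneFrame j := by
  constructor
  · rintro ⟨hg, h0, h1, h2⟩
    exact eq_of_normalized h hr hg (coneFrame_mem h) h0 (coneFrame_mulVec_zero h) h1
      (coneFrame_mulVec_one h) h2 (coneFrame_mulVec_two h hr)
  · rintro rfl
    exact ⟨coneFrame_mem h, coneFrame_mulVec_zero h, coneFrame_mulVec_one h,
      coneFrame_mulVec_two h hr⟩

/-- Both choices of `R` fix `e₃` and `e₁` and preserve a vanishing third entry, so `R ρ(j) Θ⁻¹`
solves the normalization equations at `Θj`. `R` is chosen to make its determinant 1, and uniqueness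
concludes. -/
theorem coneFrame_act {j : Jet 2} (h : IsTangentPair (j.2 0) (j.2 1))
    (hr : ip (j.2 0) (j.2 2) = - ip (j.2 1) (j.2 1)) {Θ : Mat4} (hΘ : Θ ∈ O31)
    (h3 : (Θ *ᵥ j.2 0) 3 ≠ 0) {R : Mat4} (hR : R = 1 ∧ Θ.det = 1 ∨ R = refl2 ∧ Θ.det = -1) :
    coneFrame (act Θ j) = R * coneFrame j * Θ⁻¹ := by
  have hu := isUnit_det_of_mem_O31 hΘ
  have hm := coneFrame_mem h
  symm
  refine (normalized_iff (j := act Θ j) (h.mulVec hΘ h3) ?_ _).1 ?_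
  · simp only [act]
    rw [ip_mulVec hΘ, ip_mulVec hΘ, hr]
  have key (z : V) : (R * coneFrame j * Θ⁻¹) *ᵥ (Θ *ᵥ z) = R *ᵥ (coneFrame j *ᵥ z) := by
    rw [Matrix.mulVec_mulVec, Matrix.mul_assoc _ Θ⁻¹, Matrix.nonsing_inv_mul _ hu, Matrix.mul_one,
      Matrix.mulVec_mulVec]
  have hi : (Θ⁻¹).det = Θ.det := by
    rw [Matrix.det_nonsing_inv, Ring.inverse_eq_inv']
    rcases hR with ⟨-, h⟩ | ⟨-, h⟩ <;> rw [h] <;> norm_num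
  simp only [act, key, coneFrame_mulVec_zero h, coneFrame_mulVec_one h, normJ_mulVec hΘ]
  have h2 := coneFrame_mulVec_two h hr
  have ho : (1 : Mat4) ∈ O31 := by simp [O31]
  rcases hR with ⟨rfl, hd⟩ | ⟨rfl, hd⟩
  · refine ⟨⟨mul_mem_O31 (mul_mem_O31 ho hm.1) (inv_mem_O31 hΘ), ?_⟩, ?_, ?_, ?_⟩
    · rw [Matrix.det_mul, Matrix.det_mul, hi, hd, hm.2, Matrix.det_one]; norm_num
    · simp
    · simp
    · simpa using h2
  · refine ⟨⟨mul_mem_O31 (mul_mem_O31 refl2_mem hm.1) (inv_mem_O31 hΘ), ?_⟩, ?_, ?_, ?_⟩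
    · rw [Matrix.det_mul, Matrix.det_mul, hi, hd, hm.2, det_refl2]; norm_num
    · ext i
      fin_cases i <;> simp [refl2, Matrix.mulVec_diagonal]
    · ext i
      fin_cases i <;> simp [refl2, Matrix.mulVec_diagonal]
    · simp [refl2, Matrix.mulVec_diagonal, h2]

/-! ### Calculus on open sets of parameters -/

section Derivatives

variable {E : Type*} [NormedAddCommGroup E] [NormedSpace ℝ E] {s : Set ℝ} {x : ℝ}

theorem contDiffOn_iteratedDeriv (hs : IsOpen s) {f : ℝ → E} (hf : ContDiffOn ℝ ∞ f s) (r : ℕ) :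
    ContDiffOn ℝ ∞ (iteratedDeriv r f) s := by
  induction r with
  | zero => simpa using hf
  | succ r ih =>
    rw [iteratedDeriv_succ]
    exact ((contDiffOn_infty_iff_deriv_of_isOpen hs).1 ih).2

theorem hasDerivAt_iteratedDeriv (hs : IsOpen s) {f : ℝ → E} (hf : ContDiffOn ℝ ∞ f s) (r : ℕ)
    (hx : x ∈ s) : HasDerivAt (iteratedDeriv r f) (iteratedDeriv (r + 1) f x) x := by
  rw [iteratedDeriv_succ]
  exact (((contDiffOn_infty_iff_deriv_of_isOpen hs).1
    (contDiffOn_iteratedDeriv hs hf r)).1.differentiableAt (hs.mem_nhds hx)).hasDerivAt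

theorem deriv_unique_of_eqOn (hs : IsOpen s) (hx : x ∈ s) {f g : ℝ → E} (h : Set.EqOn f g s)
    {f' g' : E} (hf : HasDerivAt f f' x) (hg : HasDerivAt g g' x) : f' = g' :=
  hf.unique (hg.congr_of_eventuallyEq (h.eventuallyEq_of_mem (hs.mem_nhds hx)))

theorem hasDerivAt_ip {f g : ℝ → V} {f' g' : V} (hf : HasDerivAt f f' x) (hg : HasDerivAt g g' x) :
    HasDerivAt (fun y => ip (f y) (g y)) (ip f' (g x) + ip (f x) g') x := by
  rw [hasDerivAt_pi] at hf hg
  simp only [ip_eq]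
  refine (((((hf 1).fun_mul (hg 1)).fun_add ((hf 2).fun_mul (hg 2))).fun_sub
    ((hf 0).fun_mul (hg 3))).fun_sub ((hf 3).fun_mul (hg 0))).congr_deriv ?_
  ring

theorem hasDerivAt_mulVec {G : ℝ → Mat4} {G' : Mat4} {w : ℝ → V} {w' : V}
    (hG : ∀ a b, HasDerivAt (fun y => G y a b) (G' a b) x) (hw : HasDerivAt w w' x) :
    HasDerivAt (fun y => G y *ᵥ w y) (G' *ᵥ w x + G x *ᵥ w') x := by
  rw [hasDerivAt_pi] at hw ⊢
  intro i
  simp only [Matrix.mulVec, dotProduct, Pi.add_apply, ← Finset.sum_add_distrib]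
  exact HasDerivAt.fun_sum fun j _ => (hG i j).mul (hw j)

theorem contDiffOn_mulVec {G : ℝ → Mat4} {w : ℝ → V}
    (hG : ∀ a b, ContDiffOn ℝ ∞ (fun y => G y a b) s) (hw : ContDiffOn ℝ ∞ w s) :
    ContDiffOn ℝ ∞ (fun y => G y *ᵥ w y) s := by
  rw [contDiffOn_pi] at hw ⊢
  intro i
  simp only [Matrix.mulVec, dotProduct]
  exact ContDiffOn.sum fun j _ => (hG i j).mul (hw j)

theorem contDiffOn_matrix_mul {G H : ℝ → Mat4} (hG : ∀ a b, ContDiffOn ℝ ∞ (fun y => G y a b) s)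
    (hH : ∀ a b, ContDiffOn ℝ ∞ (fun y => H y a b) s) (a b : Fin 4) :
    ContDiffOn ℝ ∞ (fun y => (G y * H y) a b) s := by
  simp only [Matrix.mul_apply]
  exact ContDiffOn.sum fun j _ => (hG a j).mul (hH j b)

end Derivatives

/-! ### The frame along a curve and its Maurer–Cartan matrix -/

namespace IsStarShaped

variable {u : ℝ → V} {s : Set ℝ} (h : IsStarShaped u s) {x : ℝ}
include h

theorem ip_self (hx : x ∈ s) : ip (iteratedDeriv 0 u x) (iteratedDeriv 0 u x) = 0 := by
  rw [iteratedDeriv_zero]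
  exact h.mem_cone x hx

/-- This identity and the next two are successive derivatives of `⟨u,u⟩ = 0`. -/
theorem ip_zero_one (hx : x ∈ s) : ip (iteratedDeriv 0 u x) (iteratedDeriv 1 u x) = 0 := by
  have d := hasDerivAt_iteratedDeriv h.isOpen h.smooth 0 hx
  have := deriv_unique_of_eqOn h.isOpen hx (g := fun _ => (0 : ℝ))
    (fun y hy => h.ip_self hy) (hasDerivAt_ip d d) (hasDerivAt_const x 0)
  rw [ip_comm (iteratedDeriv (0 + 1) u x)] at this
  simp only [zero_add] at this
  linarith

theorem ip_zero_two (hx : x ∈ s) : ip (iteratedDeriv 0 u x) (iteratedDeriv 2 u x) =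
    - ip (iteratedDeriv 1 u x) (iteratedDeriv 1 u x) := by
  have d (r) := hasDerivAt_iteratedDeriv h.isOpen h.smooth r hx
  have := deriv_unique_of_eqOn h.isOpen hx (g := fun _ => (0 : ℝ))
    (fun y hy => h.ip_zero_one hy) (hasDerivAt_ip (d 0) (d 1)) (hasDerivAt_const x 0)
  simp only [zero_add, one_add_one_eq_two] at this
  linarith

theorem ip_zero_three (hx : x ∈ s) : ip (iteratedDeriv 0 u x) (iteratedDeriv 3 u x) =
    - 3 * ip (iteratedDeriv 1 u x) (iteratedDeriv 2 u x) := by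
  have d (r) := hasDerivAt_iteratedDeriv h.isOpen h.smooth r hx
  have := deriv_unique_of_eqOn h.isOpen hx
    (fun y hy => h.ip_zero_two hy) (hasDerivAt_ip (d 0) (d 2)) (hasDerivAt_ip (d 1) (d 1)).neg
  simp only [zero_add, one_add_one_eq_two, Nat.reduceAdd] at this
  rw [ip_comm (iteratedDeriv 2 u x)] at this
  linarith

theorem isTangentPair (hx : x ∈ s) : IsTangentPair (iteratedDeriv 0 u x) (iteratedDeriv 1 u x) :=
  .of_notMem_span (by simpa using h.coord_ne_zero x hx) (h.ip_self hx)
    (h.ip_zero_one hx) (by simpa using h.nonradial x hx)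

theorem contDiffOn_apply (r : ℕ) (i : Fin 4) :
    ContDiffOn ℝ ∞ (fun y => iteratedDeriv r u y i) s :=
  contDiffOn_pi.1 (contDiffOn_iteratedDeriv h.isOpen h.smooth r) i

theorem contDiffOn_ip (r r' : ℕ) :
    ContDiffOn ℝ ∞ (fun y => ip (iteratedDeriv r u y) (iteratedDeriv r' u y)) s := by
  have c := h.contDiffOn_apply
  simp only [ip_eq]
  exact ((((c r 1).mul (c r' 1)).add ((c r 2).mul (c r' 2))).sub ((c r 0).mul (c r' 3))).sub
    ((c r 3).mul (c r' 0))

theorem contDiffOn_normJ : ContDiffOn ℝ ∞ (fun y => normJ (iteratedDeriv 1 u y)) s :=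
  (h.contDiffOn_ip 1 1).sqrt fun _ hx => (h.isTangentPair hx).pos.ne'

theorem contDiffOn_det3 (a b c : ℕ) : ContDiffOn ℝ ∞
    (fun y => det3 (iteratedDeriv a u y) (iteratedDeriv b u y) (iteratedDeriv c u y)) s := by
  have d := h.contDiffOn_apply
  simp only [det3_eq]
  have m (i j k) := ((d a i).mul (d b j)).mul (d c k)
  exact (((((m 1 2 3).sub (m 1 3 2)).sub (m 2 1 3)).add (m 2 3 1)).add (m 3 1 2)).sub (m 3 2 1)

theorem contDiffOn_coneFrame (a b : Fin 4) :
    ContDiffOn ℝ ∞ (fun y => coneFrame (jet 2 u y) a b) s := by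
  have d := h.contDiffOn_apply
  have hn := h.contDiffOn_normJ
  have h3 : ∀ y ∈ s, iteratedDeriv 0 u y 3 ≠ 0 := fun y hy => (h.isTangentPair hy).coord_ne_zero
  have hk : ∀ y ∈ s, normJ (iteratedDeriv 1 u y) ≠ 0 := fun y hy => (h.isTangentPair hy).normJ_pos.ne'
  have hd := h.contDiffOn_det3 0 1 2
  have x1 : ContDiffOn ℝ ∞ (fun y => -(iteratedDeriv 1 u y 3) /
      (iteratedDeriv 0 u y 3 * normJ (iteratedDeriv 1 u y))) s :=
    (d 1 3).neg.div ((d 0 3).mul hn) fun y hy => mul_ne_zero (h3 y hy) (hk y hy)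
  have x2 : ContDiffOn ℝ ∞ (fun y => -(det3 (iteratedDeriv 0 u y) (iteratedDeriv 1 u y)
      (iteratedDeriv 2 u y)) / (iteratedDeriv 0 u y 3 * normJ (iteratedDeriv 1 u y) ^ 3)) s :=
    hd.neg.div ((d 0 3).mul (hn.pow 3)) fun y hy => mul_ne_zero (h3 y hy) (pow_ne_zero _ (hk y hy))
  have v (i) : ContDiffOn ℝ ∞ (fun y => -(iteratedDeriv 0 u y i) / iteratedDeriv 0 u y 3) s :=
    (d 0 i).neg.div (d 0 3) h3
  have hi : ContDiffOn ℝ ∞ (fun y => (iteratedDeriv 0 u y 3)⁻¹) s := (d 0 3).inv h3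
  have hi' : ContDiffOn ℝ ∞ (fun y => (normJ (iteratedDeriv 1 u y))⁻¹) s := hn.inv hk
  have w1 := x1.pow 2
  have w2 := x2.pow 2
  have w3 := (v 1).pow 2
  have w4 := (v 2).pow 2
  refine contDiffOn_matrix_mul (contDiffOn_matrix_mul ?_ ?_) ?_ a b
  · intro a b
    fin_cases a <;> fin_cases b <;> first | exact contDiffOn_const | exact x1 | exact x2 | skip
    exact (w1.add w2).div_const 2
  · have m (i j) := (d 0 i).mul (d 1 j)
    have e (i j k l) : ContDiffOn ℝ ∞ (fun y => (1 / (iteratedDeriv 0 u y 3 *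
        normJ (iteratedDeriv 1 u y))) * (iteratedDeriv 0 u y i * iteratedDeriv 1 u y j -
          iteratedDeriv 0 u y k * iteratedDeriv 1 u y l)) s :=
      (contDiffOn_const.div ((d 0 3).mul hn)
        fun y hy => mul_ne_zero (h3 y hy) (hk y hy)).mul ((m i j).sub (m k l))
    intro a b
    fin_cases a <;> fin_cases b <;> first | exact contDiffOn_const | exact d 0 3 | exact hi | skip
    · exact e 3 1 1 3
    · exact e 3 2 2 3
    · exact e 2 3 3 2
    · exact e 3 1 1 3
  · intro a b
    fin_cases a <;> fin_cases b <;> first | exact contDiffOn_const | exact v 1 | exact v 2 | skip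
    exact (w3.add w4).div_const 2

theorem contDiffOn_gen (i : Fin 3) : ContDiffOn ℝ ∞ (fun y => gen i (jet 3 u y)) s := by
  have d := h.contDiffOn_apply
  have hn := h.contDiffOn_normJ
  have h3 : ∀ y ∈ s, iteratedDeriv 0 u y 3 ≠ 0 := fun y hy => (h.isTangentPair hy).coord_ne_zero
  have hk : ∀ y ∈ s, normJ (iteratedDeriv 1 u y) ≠ 0 := fun y hy => (h.isTangentPair hy).normJ_pos.ne'
  fin_cases i
  · exact hn
  · exact (((h.contDiffOn_ip 2 2).neg.mul (hn.pow 2)).add ((h.contDiffOn_ip 1 2).pow 2)).div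
      (contDiffOn_const.mul (hn.pow 5)) fun y hy => mul_ne_zero two_ne_zero (pow_ne_zero _ (hk y hy))
  · exact ((contDiffOn_const.div ((d 0 3).mul (hn.pow 3))
      fun y hy => mul_ne_zero (h3 y hy) (pow_ne_zero _ (hk y hy))).mul (h.contDiffOn_det3 0 1 3)).sub
      ((contDiffOn_const.mul ((h.contDiffOn_ip 1 2).div ((d 0 3).mul (hn.pow 5))
      fun y hy => mul_ne_zero (h3 y hy) (pow_ne_zero _ (hk y hy)))).mul (h.contDiffOn_det3 0 1 2))

/-- The structure equation of the frame. -/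
theorem rightMaurerCartan_coneFrame (hx : x ∈ s) :
    rightMaurerCartan (fun y => coneFrame (jet 2 u y)) x =
      KL (k0 (jet 3 u x)) (k1 (jet 3 u x)) (k2 (jet 3 u x)) := by
  have D (r) := hasDerivAt_iteratedDeriv h.isOpen h.smooth r hx
  have hT := h.isTangentPair hx
  set G := fun y => coneFrame (jet 2 u y) with hG
  have hGd (a b) : HasDerivAt (fun y => G y a b) (deriv (fun y => G y a b) x) x :=
    (((h.contDiffOn_coneFrame a b).differentiableOn (by simp)).differentiableAt
      (h.isOpen.mem_nhds hx)).hasDerivAt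
  set G' : Mat4 := Matrix.of fun a b => deriv (fun y => G y a b) x with hG'
  have hGd' : ∀ a b, HasDerivAt (fun y => G y a b) (G' a b) x := hGd
  have hm : ∀ y ∈ s, G y ∈ SO31 := fun y hy => coneFrame_mem (j := jet 2 u y) (h.isTangentPair hy)
  have hu := isUnit_det_of_mem_O31 (hm x hx).1
  change G' * (G x)⁻¹ = _
  set K := G' * (G x)⁻¹ with hK
  have hKG (z : V) : G' *ᵥ z = K *ᵥ (G x *ᵥ z) := by
    rw [Matrix.mulVec_mulVec, hK, Matrix.mul_assoc, Matrix.nonsing_inv_mul _ hu, Matrix.mul_one]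
  -- Differentiate `⟨ρv, ρw⟩ = ⟨v, w⟩` with `v, w` replaced by the constant vectors `ρ(x)⁻¹v,
  -- ρ(x)⁻¹w`.
  have skew (v w : V) : ip (K *ᵥ v) w + ip v (K *ᵥ w) = 0 := by
    have c (z : V) := hasDerivAt_mulVec hGd' (hasDerivAt_const x ((G x)⁻¹ *ᵥ z))
    have := deriv_unique_of_eqOn h.isOpen hx
      (fun y hy => ip_mulVec (hm y hy).1 _ _) (hasDerivAt_ip (c v) (c w)) (hasDerivAt_const x _)
    simpa [Matrix.mulVec_mulVec, Matrix.mul_nonsing_inv _ hu] using this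
  have hnd : HasDerivAt (fun y => normJ (iteratedDeriv 1 u y))
      (deriv (fun y => normJ (iteratedDeriv 1 u y)) x) x :=
    ((h.contDiffOn_normJ.differentiableOn (by simp)).differentiableAt
      (h.isOpen.mem_nhds hx)).hasDerivAt
  set k' := deriv (fun y => normJ (iteratedDeriv 1 u y)) x
  have n0 : ∀ y ∈ s, G y *ᵥ iteratedDeriv 0 u y = ![0, 0, 0, 1] :=
    fun y hy => coneFrame_mulVec_zero (j := jet 2 u y) (h.isTangentPair hy)
  have n1 : ∀ y ∈ s, G y *ᵥ iteratedDeriv 1 u y = ![0, normJ (iteratedDeriv 1 u y), 0, 0] :=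
    fun y hy => coneFrame_mulVec_one (j := jet 2 u y) (h.isTangentPair hy)
  have n2 : ∀ y ∈ s, (G y *ᵥ iteratedDeriv 2 u y) 2 = 0 :=
    fun y hy => coneFrame_mulVec_two (j := jet 2 u y) (h.isTangentPair hy) (h.ip_zero_two hy)
  have d0 := deriv_unique_of_eqOn h.isOpen hx n0 (hasDerivAt_mulVec hGd' (D 0))
    (hasDerivAt_const x _)
  have hvec : HasDerivAt (fun y => (![0, normJ (iteratedDeriv 1 u y), 0, 0] : V))
      ![0, k', 0, 0] x := by
    rw [hasDerivAt_pi]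
    intro i
    fin_cases i
    · exact hasDerivAt_const x _
    · exact hnd
    · exact hasDerivAt_const x _
    · exact hasDerivAt_const x _
  have d1 := deriv_unique_of_eqOn h.isOpen hx n1 (hasDerivAt_mulVec hGd' (D 1)) hvec
  have d2 := deriv_unique_of_eqOn h.isOpen hx n2
    (hasDerivAt_pi.1 (hasDerivAt_mulVec hGd' (D 2)) 2) (hasDerivAt_const x _)
  have w3 := coneFrame_mulVec_apply_two (j := jet 2 u x) hT (iteratedDeriv 3 u x)
  change (G x *ᵥ iteratedDeriv 3 u x) 2 = det3 (iteratedDeriv 0 u x) (iteratedDeriv 1 u x)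
    (iteratedDeriv 3 u x) / (iteratedDeriv 0 u x 3 * normJ (iteratedDeriv 1 u x)) +
    det3 (iteratedDeriv 0 u x) (iteratedDeriv 1 u x) (iteratedDeriv 2 u x) /
    (iteratedDeriv 0 u x 3 * normJ (iteratedDeriv 1 u x) ^ 3) *
    ip (iteratedDeriv 0 u x) (iteratedDeriv 3 u x) at w3
  rw [h.ip_zero_three hx] at w3
  simp only [zero_add, Nat.reduceAdd, hKG] at d0 d1 d2
  rw [n0 x hx, n1 x hx] at d0
  rw [n1 x hx] at d1
  have c0 := ip_mulVec (hm x hx).1 (iteratedDeriv 0 u x) (iteratedDeriv 2 u x)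
  have c1 := ip_mulVec (hm x hx).1 (iteratedDeriv 1 u x) (iteratedDeriv 2 u x)
  have c2 := ip_mulVec (hm x hx).1 (iteratedDeriv 2 u x) (iteratedDeriv 2 u x)
  have c3 := n2 x hx
  rw [n0 x hx, h.ip_zero_two hx, ← hT.normJ_sq, ip_eq] at c0
  rw [n1 x hx, ip_eq] at c1
  rw [ip_eq] at c2
  have hk := hT.normJ_pos.ne'
  have h3 := hT.coord_ne_zero
  have E0 : k0 (jet 3 u x) = normJ (iteratedDeriv 1 u x) := rfl
  have E1 : k1 (jet 3 u x) = (-(ip (iteratedDeriv 2 u x) (iteratedDeriv 2 u x)) *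
      normJ (iteratedDeriv 1 u x) ^ 2 + ip (iteratedDeriv 1 u x) (iteratedDeriv 2 u x) ^ 2) /
      (2 * normJ (iteratedDeriv 1 u x) ^ 5) := rfl
  have E2 : k2 (jet 3 u x) = 1 / (iteratedDeriv 0 u x 3 * normJ (iteratedDeriv 1 u x) ^ 3) *
      det3 (iteratedDeriv 0 u x) (iteratedDeriv 1 u x) (iteratedDeriv 3 u x) -
      3 * (ip (iteratedDeriv 1 u x) (iteratedDeriv 2 u x) / (iteratedDeriv 0 u x 3 *
      normJ (iteratedDeriv 1 u x) ^ 5)) * det3 (iteratedDeriv 0 u x) (iteratedDeriv 1 u x)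
      (iteratedDeriv 2 u x) := rfl
  rw [E0]
  generalize k1 (jet 3 u x) = κ₁ at *
  generalize k2 (jet 3 u x) = κ₂ at *
  generalize normJ (iteratedDeriv 1 u x) = k at *
  generalize G x *ᵥ iteratedDeriv 2 u x = c at *
  generalize G x *ᵥ iteratedDeriv 3 u x = d at *
  -- With `c = ρu''` and `d = ρu'''`, what remains is linear algebra for the entries of `K`.
  generalize ip (iteratedDeriv 1 u x) (iteratedDeriv 2 u x) = i₁₂ at *
  generalize ip (iteratedDeriv 2 u x) (iteratedDeriv 2 u x) = i₂₂ at *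
  simp at c0 c1
  rw [c3] at c2
  rw [← c2, ← c1, c0] at E1
  -- Solves `⟨u'',u''⟩ = c₁² - 2c₀c₃` for `c₃`, with `c₀ = k²` and `c₁ = ⟨u',u''⟩/k`.
  have E1' : c 3 = κ₁ * k := by
    rw [E1]; field_simp; ring
  have E2' : d 2 = κ₂ * k ^ 2 := by
    rw [w3, E2]; field_simp; ring
  have f0 (i) := congrFun d0 i
  have f1 (i) := congrFun d1 i
  have g (i j : Fin 4) := skew (Pi.single i 1) (Pi.single j 1)
  simp only [ip_eq, Matrix.mulVec_single_one, Matrix.col_apply] at g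
  simp [Matrix.mulVec, dotProduct, Fin.sum_univ_four, Fin.forall_fin_succ] at f0 f1 d2 g
  obtain ⟨f00, f01, f02, f03⟩ := f0
  obtain ⟨-, -, f12, f13⟩ := f1
  rw [c3] at f12
  have K21 : K 2 1 = 0 := by simpa [hk] using f12
  have K31 : K 3 1 = -κ₁ := mul_right_cancel₀ hk (by linarith)
  -- In the third entry of `Kc + d = 0` only `K₂₀c₀ + d₂` survives.
  have K20 : K 2 0 = -κ₂ := mul_right_cancel₀ (pow_ne_zero 2 hk) (by
    rw [K21, f02, c3, c0, E2'] at d2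
    linarith)
  clear E1 E2 w3 d2 c2
  ext i j
  fin_cases i <;> fin_cases j <;> simp [KL] <;> linarith

end IsStarShaped

/-! ### Equivariance and invariants on jets -/

theorem isTangentPair_of_mem_coneJets {m : ℕ} {j : Jet (m + 1)} (hj : j ∈ coneJets (m + 1)) :
    IsTangentPair (j.2 0) (j.2 1) := by
  obtain ⟨u, s, x, h, hx, rfl⟩ := hj
  have := h.isTangentPair hx
  simpa [jet] using this

theorem ip_zero_two_of_mem_coneJets {m : ℕ} {j : Jet (m + 2)} (hj : j ∈ coneJets (m + 2)) :
    ip (j.2 0) (j.2 2) = - ip (j.2 1) (j.2 1) := by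
  obtain ⟨u, s, x, h, hx, rfl⟩ := hj
  have := h.ip_zero_two hx
  simpa [jet, Nat.mod_eq_of_lt] using this

theorem ip_zero_three_of_mem_coneJets {j : Jet 3} (hj : j ∈ coneJets 3) :
    ip (j.2 0) (j.2 3) = - 3 * ip (j.2 1) (j.2 2) := by
  obtain ⟨u, s, x, h, hx, rfl⟩ := hj
  exact h.ip_zero_three hx

theorem det_eq_one_or_neg_one {Θ : Mat4} (h : Θ ∈ O31) : Θ.det = 1 ∨ Θ.det = -1 :=
  mul_self_eq_one_iff.1 (det_mul_self_of_mem_O31 h)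

theorem coneFrame_isRightMovingFrame : IsRightMovingFrame SO31 2 coneFrame := by
  refine ⟨fun j hj => coneFrame_mem (isTangentPair_of_mem_coneJets hj), fun Θ hΘ j hj hj' => ?_⟩
  have := coneFrame_act (isTangentPair_of_mem_coneJets hj) (ip_zero_two_of_mem_coneJets hj) hΘ.1
    (isTangentPair_of_mem_coneJets hj').coord_ne_zero (.inl ⟨rfl, hΘ.2⟩)
  rwa [Matrix.one_mul] at this

theorem k0_invariant : IsDifferentialInvariant O31 3 k0 := fun Θ hΘ j _ _ => by
  simp only [k0, act, normJ_mulVec hΘ]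

theorem k1_invariant : IsDifferentialInvariant O31 3 k1 := fun Θ hΘ j _ _ => by
  simp only [k1, act, normJ_mulVec hΘ, ip_mulVec hΘ]

/-- Exhibits `k₂` as a component of `ρu'''`, so that its behaviour under the group follows from that
of the frame. -/
theorem k2_eq_coneFrame {j : Jet 3} (hj : j ∈ coneJets 3) :
    k2 j = (coneFrame (j.1, fun r => j.2 r.castSucc) *ᵥ j.2 3) 2 / normJ (j.2 1) ^ 2 := by
  have h := isTangentPair_of_mem_coneJets hj
  rw [coneFrame_mulVec_apply_two (j := (j.1, fun r => j.2 r.castSucc)) h]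
  have hk := h.normJ_pos.ne'
  have h3 := h.coord_ne_zero
  change _ = (det3 (j.2 0) (j.2 1) (j.2 3) / (j.2 0 3 * normJ (j.2 1)) +
    det3 (j.2 0) (j.2 1) (j.2 2) / (j.2 0 3 * normJ (j.2 1) ^ 3) * ip (j.2 0) (j.2 3)) /
    normJ (j.2 1) ^ 2
  rw [ip_zero_three_of_mem_coneJets hj, k2]
  field_simp
  ring

theorem k2_act {Θ : Mat4} (hΘ : Θ ∈ O31) {j : Jet 3} (hj : j ∈ coneJets 3)
    (hj' : act Θ j ∈ coneJets 3) : k2 (act Θ j) = Θ.det * k2 j := by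
  have hu := isUnit_det_of_mem_O31 hΘ
  have key {R : Mat4} (hR : R = 1 ∧ Θ.det = 1 ∨ R = refl2 ∧ Θ.det = -1) :
      coneFrame ((act Θ j).1, fun r => (act Θ j).2 r.castSucc) *ᵥ (act Θ j).2 3 =
        R *ᵥ (coneFrame (j.1, fun r => j.2 r.castSucc) *ᵥ j.2 3) := by
    have hT := isTangentPair_of_mem_coneJets hj
    have hr := ip_zero_two_of_mem_coneJets hj
    have h3 := (isTangentPair_of_mem_coneJets hj').coord_ne_zero
    have := coneFrame_act (j := (j.1, fun r => j.2 r.castSucc)) hT hr hΘ h3 hR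
    change coneFrame (act Θ (j.1, fun r => j.2 r.castSucc)) *ᵥ (Θ *ᵥ j.2 3) = _
    rw [this, Matrix.mulVec_mulVec, Matrix.mul_assoc _ Θ⁻¹, Matrix.nonsing_inv_mul _ hu,
      Matrix.mul_one, Matrix.mulVec_mulVec]
  rw [k2_eq_coneFrame hj, k2_eq_coneFrame hj']
  have hn : normJ ((act Θ j).2 1) = normJ (j.2 1) := normJ_mulVec hΘ _
  rw [hn]
  rcases det_eq_one_or_neg_one hΘ with hd | hd
  · rw [key (.inl ⟨rfl, hd⟩), hd, Matrix.one_mulVec, one_mul]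
  · rw [key (.inr ⟨rfl, hd⟩), hd]
    simp [refl2, Matrix.mulVec_diagonal, neg_div]

theorem iteratedDeriv_mulVec {s : Set ℝ} (hs : IsOpen s) {u : ℝ → V} (hu : ContDiffOn ℝ ∞ u s)
    (Θ : Mat4) (r : ℕ) :
    Set.EqOn (iteratedDeriv r fun y => Θ *ᵥ u y) (fun y => Θ *ᵥ iteratedDeriv r u y) s := by
  have hc : ContDiffOn ℝ ∞ (fun y => Θ *ᵥ u y) s :=
    contDiffOn_mulVec (fun _ _ => contDiffOn_const) hu
  induction r with
  | zero => intro y _; simp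
  | succ r ih =>
    intro y hy
    have := deriv_unique_of_eqOn hs hy ih (hasDerivAt_iteratedDeriv hs hc r hy)
      (hasDerivAt_mulVec (fun a b => hasDerivAt_const y (Θ a b)) (hasDerivAt_iteratedDeriv hs hu r hy))
    rw [this]
    ext i
    simp [Matrix.mulVec, dotProduct]

/-- The image may leave the coordinate domain, so the parameter set is cut down to the open part
where it does not. -/
theorem IsStarShaped.mulVec {u : ℝ → V} {s : Set ℝ} (h : IsStarShaped u s) {Θ : Mat4}
    (hΘ : Θ ∈ O31) :
    IsStarShaped (fun y => Θ *ᵥ u y) (s ∩ (fun y => (Θ *ᵥ u y) 3) ⁻¹' {0}ᶜ) := by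
  have hc : ContDiffOn ℝ ∞ (fun y => Θ *ᵥ u y) s :=
    contDiffOn_mulVec (fun _ _ => contDiffOn_const) h.smooth
  refine ⟨(continuousOn_pi.1 hc.continuousOn 3).isOpen_inter_preimage h.isOpen isOpen_compl_singleton,
    hc.mono Set.inter_subset_left, fun y hy => ?_, fun y hy => hy.2, fun y hy => ?_⟩
  · change ip _ _ = 0
    rw [ip_mulVec hΘ]
    exact h.mem_cone y hy.1
  · have h1 := iteratedDeriv_mulVec h.isOpen h.smooth Θ 1 hy.1
    have := ((h.isTangentPair hy.1).mulVec hΘ (by simpa using hy.2)).notMem_span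
    rw [iteratedDeriv_one] at h1
    rw [h1]
    simpa using this

theorem act_mem_coneJets {m : ℕ} {j : Jet m} (hj : j ∈ coneJets m) {Θ : Mat4} (hΘ : Θ ∈ O31)
    (h3 : (Θ *ᵥ j.2 0) 3 ≠ 0) : act Θ j ∈ coneJets m := by
  obtain ⟨u, s, x, h, hx, rfl⟩ := hj
  refine ⟨_, _, x, h.mulVec hΘ, ⟨hx, by simpa [jet] using h3⟩, ?_⟩
  refine Prod.ext rfl (funext fun r => ?_)
  exact iteratedDeriv_mulVec h.isOpen h.smooth Θ r hx

theorem act_inv_act {m : ℕ} {Θ : Mat4} (hΘ : Θ ∈ O31) (j : Jet m) : act Θ⁻¹ (act Θ j) = j := by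
  refine Prod.ext rfl (funext fun r => ?_)
  simp [act, Matrix.mulVec_mulVec, Matrix.nonsing_inv_mul _ (isUnit_det_of_mem_O31 hΘ)]

theorem contDiff_act {m : ℕ} (Θ : Mat4) : ContDiff ℝ ∞ (act Θ : Jet m → Jet m) := by
  refine contDiff_fst.prodMk (contDiff_pi.2 fun r => contDiff_pi.2 fun a => ?_)
  simp only [Matrix.mulVec, dotProduct]
  fun_prop

/-- Smoothness of a differential invariant propagates along the orbits of the group. -/
theorem contDiffWithinAt_act {m : ℕ} {I : Jet m → ℝ} (hI : IsDifferentialInvariant SO31 m I)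
    {j : Jet m} {Θ : Mat4} (hΘ : Θ ∈ SO31) (h3 : j.2 0 3 ≠ 0)
    (hmem : act Θ j ∈ coneJets m) (hj : ContDiffWithinAt ℝ ∞ I (coneJets m) j) :
    ContDiffWithinAt ℝ ∞ I (coneJets m) (act Θ j) := by
  have hc := contDiff_act (m := m) Θ⁻¹
  have hΘ' := inv_mem_SO31 hΘ
  -- On `N`, `Θ⁻¹` maps jets of cone curves to such jets, so there `I` agrees with `I ∘ Θ⁻¹`.
  set N : Set (Jet m) := {j | (act Θ⁻¹ j).2 0 3 ≠ 0} with hN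
  have hNo : IsOpen N := by
    refine isOpen_compl_singleton.preimage (f := fun j : Jet m => (act Θ⁻¹ j).2 0 3) ?_
    have := hc.continuous
    fun_prop
  have hjN : act Θ j ∈ N := by
    simpa only [hN, Set.mem_ofPred_eq, act_inv_act hΘ.1] using h3
  have hmaps : Set.MapsTo (act Θ⁻¹) (coneJets m ∩ N) (coneJets m) :=
    fun i hi => act_mem_coneJets hi.1 hΘ'.1 hi.2
  have key : ContDiffWithinAt ℝ ∞ (I ∘ act Θ⁻¹) (coneJets m ∩ N) (act Θ j) := by
    refine ContDiffWithinAt.comp (t := coneJets m) _ ?_ hc.contDiffWithinAt hmaps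
    rwa [act_inv_act hΘ.1]
  exact (contDiffWithinAt_inter (hNo.mem_nhds hjN)).1
    (key.congr_of_mem (fun i hi => (hI _ hΘ' i hi.1 (hmaps hi)).symm) ⟨hmem, hjN⟩)

/-! ### Normalized jets as polynomials in the invariants -/

/-- The coefficient matrices of `k₀`, `k₁`, `k₂` in `KL k₀ k₁ k₂`. -/
def KLbasis : Fin 3 → Mat4 := ![KL 1 0 0, KL 0 1 0, KL 0 0 1]

theorem KL_mulVec (k : Fin 3 → ℝ) (v : V) :
    KL (k 0) (k 1) (k 2) *ᵥ v = ∑ l, k l • (KLbasis l *ᵥ v) := by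
  ext i
  fin_cases i <;>
    simp [KL, KLbasis, Matrix.mulVec, dotProduct, Fin.sum_univ_four, Fin.sum_univ_three]
  ring

theorem KL_skew (a b c : ℝ) (v w : V) : ip (KL a b c *ᵥ v) w + ip v (KL a b c *ᵥ w) = 0 := by
  simp [KL, ip_eq, dotProduct, Fin.sum_univ_four]
  ring

/-- The derivatives of order `n` of the components `ρ u⁽ʳ⁾` of the jet of a curve with respect to its
frame `ρ`, as universal polynomials in the derivatives `κ l i` of the invariants. -/
def frenetJet (κ : Fin 3 → ℕ → ℝ) : ℕ → ℕ → V
  | 0, n => if n = 0 then ![0, 0, 0, 1] else 0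
  | r + 1, n => frenetJet κ r (n + 1) - ∑ l, ∑ i ∈ Finset.range (n + 1),
      n.choose i • κ l i • (KLbasis l *ᵥ frenetJet κ r (n - i))

theorem iteratedDeriv_smul_mulVec {s : Set ℝ} (hs : IsOpen s) {x : ℝ} (hx : x ∈ s) {f : ℝ → ℝ}
    (hf : ContDiffOn ℝ ∞ f s) {w : ℝ → V} (hw : ContDiffOn ℝ ∞ w s) (Θ : Mat4) (n : ℕ) :
    iteratedDeriv n (fun y => f y • (Θ *ᵥ w y)) x = ∑ i ∈ Finset.range (n + 1),
      n.choose i • iteratedDeriv i f x • (Θ *ᵥ iteratedDeriv (n - i) w x) := by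
  have hn : ((n : ℕ∞) : WithTop ℕ∞) ≤ ∞ := by exact_mod_cast le_top
  have hf' := ((hf.contDiffAt (hs.mem_nhds hx)).of_le hn).contDiffWithinAt (s := Set.univ)
  have hc : ContDiffOn ℝ ∞ (fun y => Θ *ᵥ w y) s :=
    contDiffOn_mulVec (fun _ _ => contDiffOn_const) hw
  have hw' := ((hc.contDiffAt (hs.mem_nhds hx)).of_le hn).contDiffWithinAt (s := Set.univ)
  have := iteratedDerivWithin_smul (Set.mem_univ x) uniqueDiffOn_univ hf' hw'
  simp only [iteratedDerivWithin_univ] at this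
  refine this.trans (Finset.sum_congr rfl fun i _ => ?_)
  rw [iteratedDeriv_mulVec hs hw Θ (n - i) hx]

/-- Leibniz's rule applied to `ρu⁽ʳ⁺¹⁾ = (ρu⁽ʳ⁾)' - Kρu⁽ʳ⁾`. Each step lowers `r` and raises `n` by
at most one, so `r + n ≤ m` persists and derivatives of the invariants beyond order `m` never enter.
-/
theorem iteratedDeriv_frame_mulVec {s : Set ℝ} (hs : IsOpen s) {G : ℝ → Mat4} {u : ℝ → V}
    {k : Fin 3 → ℝ → ℝ} (hG : ∀ a b, ContDiffOn ℝ ∞ (fun y => G y a b) s)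
    (hu : ContDiffOn ℝ ∞ u s) (hk : ∀ l, ContDiffOn ℝ ∞ (k l) s)
    (hGK : ∀ y ∈ s, ∀ a b, HasDerivAt (fun y => G y a b)
      ((KL (k 0 y) (k 1 y) (k 2 y) * G y) a b) y)
    (hGu : ∀ y ∈ s, G y *ᵥ u y = ![0, 0, 0, 1]) {x : ℝ} (hx : x ∈ s) {m : ℕ}
    {κ : Fin 3 → ℕ → ℝ} (hκ : ∀ l, ∀ i ≤ m, κ l i = iteratedDeriv i (k l) x) (r n : ℕ)
    (hrn : r + n ≤ m) :
    iteratedDeriv n (fun y => G y *ᵥ iteratedDeriv r u y) x = frenetJet κ r n := by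
  induction r generalizing n with
  | zero =>
    have : Set.EqOn (fun y => G y *ᵥ iteratedDeriv 0 u y) (fun _ => ![0, 0, 0, 1]) s :=
      fun y hy => by simpa using hGu y hy
    rw [(this.eventuallyEq_of_mem (hs.mem_nhds hx)).iteratedDeriv_eq n, iteratedDeriv_const]
    rfl
  | succ r ih =>
    set W := fun y => G y *ᵥ iteratedDeriv r u y with hW
    have hWc : ContDiffOn ℝ ∞ W s := contDiffOn_mulVec hG (contDiffOn_iteratedDeriv hs hu r)
    have hd : ContDiffOn ℝ ∞ (deriv W) s := ((contDiffOn_infty_iff_deriv_of_isOpen hs).1 hWc).2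
    have hKc (l) : ContDiffOn ℝ ∞ (fun y => k l y • (KLbasis l *ᵥ W y)) s :=
      (hk l).smul (contDiffOn_mulVec (fun _ _ => contDiffOn_const) hWc)
    have hE : Set.EqOn (fun y => G y *ᵥ iteratedDeriv (r + 1) u y)
        (deriv W - fun y => ∑ l, k l y • (KLbasis l *ᵥ W y)) s := by
      intro y hy
      have := (hasDerivAt_mulVec (hGK y hy) (hasDerivAt_iteratedDeriv hs hu r hy)).deriv
      change deriv W y = _ at this
      rw [Pi.sub_apply, this, ← KL_mulVec (fun l => k l y), hW, ← Matrix.mulVec_mulVec]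
      simp
    have hn : ((n : ℕ∞) : WithTop ℕ∞) ≤ ∞ := by exact_mod_cast le_top
    have at_x {F : ℝ → V} (hF : ContDiffOn ℝ ∞ F s) : ContDiffAt ℝ n F x :=
      (hF.contDiffAt (hs.mem_nhds hx)).of_le hn
    rw [(hE.eventuallyEq_of_mem (hs.mem_nhds hx)).iteratedDeriv_eq n,
      iteratedDeriv_sub (at_x hd) (at_x (ContDiffOn.sum fun l _ => hKc l)),
      ← iteratedDeriv_succ', ih _ (by omega), frenetJet,
      iteratedDeriv_fun_sum fun l _ => at_x (hKc l)]
    congr 1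
    refine Finset.sum_congr rfl fun l _ => ?_
    rw [iteratedDeriv_smul_mulVec hs hx (hk l) hWc]
    refine Finset.sum_congr rfl fun i hi => ?_
    have hi' := Finset.mem_range.1 hi
    rw [hκ l i (by omega), ih _ (by omega)]

/-- Extension by zero of a truncated jet of the invariants. -/
def extendJet {m : ℕ} (κ : Fin 3 → Fin (m + 1) → ℝ) (l : Fin 3) (i : ℕ) : ℝ :=
  if h : i < m + 1 then κ l ⟨i, h⟩ else 0

theorem contDiff_frenetJet (m r n : ℕ) : ContDiff ℝ ∞
    (fun κ : Fin 3 → Fin (m + 1) → ℝ => frenetJet (extendJet κ) r n) := by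
  induction r generalizing n with
  | zero => exact contDiff_const
  | succ r ih =>
    simp only [frenetJet]
    refine (ih _).sub (ContDiff.sum fun l _ => ContDiff.sum fun i _ => ?_)
    have h1 : ContDiff ℝ ∞ fun κ : Fin 3 → Fin (m + 1) → ℝ => extendJet κ l i := by
      simp only [extendJet]
      split_ifs
      · fun_prop
      · exact contDiff_const
    have h2 : ContDiff ℝ ∞ fun κ : Fin 3 → Fin (m + 1) → ℝ =>
        KLbasis l *ᵥ frenetJet (extendJet κ) r (n - i) := by
      refine contDiff_pi.2 fun a => ?_
      simp only [Matrix.mulVec, dotProduct]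
      exact ContDiff.sum fun j _ => contDiff_const.mul (contDiff_pi.1 (ih _) j)
    exact ContDiff.const_smul _ (h1.smul h2)

/-! ### Curves with prescribed invariants -/

/-- Bootstrapping: if `α` is `Cⁿ`, then so is its derivative `v ∘ α`, and `α` is `Cⁿ⁺¹`. -/
theorem contDiffOn_of_hasDerivAt_eq {E : Type*} [NormedAddCommGroup E] [NormedSpace ℝ E]
    {s : Set ℝ} (hs : IsOpen s) {v : E → E} (hv : ContDiff ℝ ∞ v) {α : ℝ → E}
    (h : ∀ t ∈ s, HasDerivAt α (v (α t)) t) : ContDiffOn ℝ ∞ α s := by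
  rw [contDiffOn_infty]
  intro n
  induction n with
  | zero =>
    exact contDiffOn_zero.2 fun t ht => (h t ht).continuousAt.continuousWithinAt
  | succ n ih =>
    push_cast
    rw [contDiffOn_succ_iff_deriv_of_isOpen hs]
    refine ⟨fun t ht => (h t ht).differentiableAt.differentiableWithinAt, by simp, ?_⟩
    exact ((hv.of_le (by exact_mod_cast le_top)).comp_contDiffOn ih).congr
      fun t ht => (h t ht).deriv

/-- Local solvability of the structure equation `ρₓ = K ρ`. -/
theorem exists_frame {k : Fin 3 → ℝ → ℝ} (hk : ∀ l, ContDiff ℝ ∞ (k l)) (x : ℝ) :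
    ∃ ε > 0, ∃ G : ℝ → Mat4, G x = 1 ∧
      (∀ a b, ContDiffOn ℝ ∞ (fun y => G y a b) (Set.Ioo (x - ε) (x + ε))) ∧
      ∀ y ∈ Set.Ioo (x - ε) (x + ε), ∀ a b, HasDerivAt (fun y => G y a b)
        ((KL (k 0 y) (k 1 y) (k 2 y) * G y) a b) y := by
  -- The parameter is adjoined as a coordinate of unit speed, which makes the system autonomous.
  let v : ℝ × (Fin 4 → Fin 4 → ℝ) → ℝ × (Fin 4 → Fin 4 → ℝ) := fun p =>
    (1, fun a b => ∑ c, (KL (k 0 p.1) (k 1 p.1) (k 2 p.1)) a c * p.2 c b)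
  have hv : ContDiff ℝ ∞ v := by
    refine contDiff_const.prodMk (contDiff_pi.2 fun a => contDiff_pi.2 fun b =>
      ContDiff.sum fun c _ => ContDiff.mul ?_ (by fun_prop))
    have h' (l) : ContDiff ℝ ∞ fun p : ℝ × (Fin 4 → Fin 4 → ℝ) => -k l p.1 :=
      ((hk l).comp contDiff_fst).neg
    fin_cases a <;> fin_cases c <;> first | exact contDiff_const | exact h' _
  obtain ⟨α, hα, ε, hε, hd⟩ :=
    (hv.contDiffAt.of_le
      (by exact_mod_cast le_top)).exists_forall_mem_closedBall_exists_eq_forall_mem_Ioo_hasDerivAt₀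
      (x₀ := (x, fun a b => (1 : Mat4) a b)) x
  have hc := contDiffOn_of_hasDerivAt_eq isOpen_Ioo hv hd
  have hx : x ∈ Set.Ioo (x - ε) (x + ε) := ⟨by linarith, by linarith⟩
  have hfst : ∀ y ∈ Set.Ioo (x - ε) (x + ε), (α y).1 = y := by
    intro y hy
    have h1 (t) (ht : t ∈ Set.Ioo (x - ε) (x + ε)) : HasDerivAt (fun t => (α t).1 - t) 0 t := by
      have := (hasFDerivAt_fst.comp_hasDerivAt t (hd t ht)).fun_sub (hasDerivAt_id' t)
      simpa [v] using this
    have := isOpen_Ioo.is_const_of_deriv_eq_zero isPreconnected_Ioo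
      (fun t ht => (h1 t ht).differentiableAt.differentiableWithinAt)
      (fun t ht => (h1 t ht).deriv) hy hx
    simp only [hα, sub_self] at this
    linarith
  refine ⟨ε, hε, fun y => Matrix.of (α y).2, by simp [hα]; rfl, fun a b => ?_, fun y hy a b => ?_⟩
  · exact contDiffOn_pi.1 (contDiffOn_pi.1 hc.snd a) b
  · have := hasDerivAt_pi.1 (hasDerivAt_pi.1 (hasFDerivAt_snd.comp_hasDerivAt y (hd y hy)) a) b
    refine this.congr_deriv ?_
    simp only [v, hfst y hy, Matrix.mul_apply, Matrix.of_apply]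
    rfl

theorem mem_O31_of_ip {Θ : Mat4} (h : ∀ v w, ip (Θ *ᵥ v) (Θ *ᵥ w) = ip v w) : Θ ∈ O31 := by
  change _ = _
  have e (M : Mat4) (i j) : M i j = Pi.single i 1 ⬝ᵥ (M *ᵥ Pi.single j 1) := by simp
  ext i j
  rw [e (Θᵀ * J * Θ), e J, ← ip, ← h, ip, ← Matrix.mulVec_mulVec, ← Matrix.mulVec_mulVec,
    Matrix.dotProduct_mulVec (Pi.single i 1), Matrix.vecMul_transpose]

theorem J_transpose_J_mul {Θ : Mat4} (h : Θ ∈ O31) : J * Θᵀ * J * Θ = 1 := by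
  have h : Θᵀ * J * Θ = J := h
  rw [Matrix.mul_assoc, Matrix.mul_assoc, ← Matrix.mul_assoc Θᵀ, h, J_mul_J]

theorem iteratedDeriv_taylor {m : ℕ} (x : ℝ) (c : Fin (m + 1) → ℝ) {i : ℕ} (hi : i ≤ m) :
    iteratedDeriv i (fun y => ∑ n : Fin (m + 1), c n / (n : ℕ).factorial * (y - x) ^ (n : ℕ)) x =
      c ⟨i, Nat.lt_succ_of_le hi⟩ := by
  rw [iteratedDeriv_fun_sum fun n _ => by fun_prop, Finset.sum_eq_single ⟨i, Nat.lt_succ_of_le hi⟩]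
  · rw [iteratedDeriv_const_mul_field, iteratedDeriv_comp_sub_const i (fun y => y ^ i)]
    have : ((i.factorial : ℕ) : ℝ) ≠ 0 := by positivity
    simp only [sub_self, iteratedDeriv_fun_pow_zero, if_true]
    field_simp
  · intro n _ hn
    rw [iteratedDeriv_const_mul_field, iteratedDeriv_comp_sub_const i (fun y => y ^ (n : ℕ))]
    have hne : i ≠ n := fun h => hn (Fin.ext h.symm)
    simp only [sub_self, iteratedDeriv_fun_pow_zero, if_neg hne]
    simp
  · simp

/-- The normalized jets with `k₀ ≠ 0` are jets of star-shaped curves. -/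
theorem frenetJet_mem_coneJets {m : ℕ} (x : ℝ) (κ : Fin 3 → Fin (m + 1) → ℝ) (h0 : κ 0 0 ≠ 0) :
    ((x, fun r => frenetJet (extendJet κ) r 0) : Jet m) ∈ coneJets m := by
  let k : Fin 3 → ℝ → ℝ := fun l y =>
    ∑ i : Fin (m + 1), (κ l i / (i : ℕ).factorial) * (y - x) ^ (i : ℕ)
  have hk (l) : ContDiff ℝ ∞ (k l) := by
    simp only [k]
    fun_prop
  have hκ (l i) (hi : i ≤ m) : extendJet κ l i = iteratedDeriv i (k l) x := by
    rw [extendJet, dif_pos (Nat.lt_succ_of_le hi)]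
    exact
    (iteratedDeriv_taylor x (κ l) hi).symm
  obtain ⟨ε, hε, G, hGx, hG, hGK⟩ := exists_frame hk x
  set s := Set.Ioo (x - ε) (x + ε) with hs
  have hso : IsOpen s := isOpen_Ioo
  have hx : x ∈ s := ⟨by linarith, by linarith⟩
  have hO : ∀ y ∈ s, G y ∈ O31 := fun y hy => by
    refine mem_O31_of_ip fun v w => ?_
    have h1 (t) (ht : t ∈ s) : HasDerivAt (fun t => ip (G t *ᵥ v) (G t *ᵥ w)) 0 t := by
      have c (z : V) := hasDerivAt_mulVec (hGK t ht) (hasDerivAt_const t z)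
      refine (hasDerivAt_ip (c v) (c w)).congr_deriv ?_
      simpa [← Matrix.mulVec_mulVec] using KL_skew _ _ _ (G t *ᵥ v) (G t *ᵥ w)
    have := hso.is_const_of_deriv_eq_zero isPreconnected_Ioo
      (fun t ht => (h1 t ht).differentiableAt.differentiableWithinAt)
      (fun t ht => (h1 t ht).deriv) hy hx
    simpa [hGx] using this
  -- On O(3,1) the inverse of `G` is `J Gᵀ J`, so this is `G⁻¹e₃`, written polynomially in the
  -- entries of `G`.
  set u : ℝ → V := fun y => (J * (G y)ᵀ * J) *ᵥ ![0, 0, 0, 1] with hu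
  have huc : ContDiffOn ℝ ∞ u s := contDiffOn_mulVec (contDiffOn_matrix_mul (contDiffOn_matrix_mul
    (fun _ _ => contDiffOn_const) fun a b => hG b a) fun _ _ => contDiffOn_const) contDiffOn_const
  have hGu : ∀ y ∈ s, G y *ᵥ u y = ![0, 0, 0, 1] := fun y hy => by
    rw [hu, Matrix.mulVec_mulVec, mul_eq_one_comm.1 (J_transpose_J_mul (hO y hy)),
      Matrix.one_mulVec]
  have hux : u x = ![0, 0, 0, 1] := by simpa [hGx] using hGu x hx
  have key (n : ℕ) (κ : Fin 3 → ℕ → ℝ) {y : ℝ} (hy : y ∈ s) := iteratedDeriv_frame_mulVec hso hG huc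
    (fun l => (hk l).contDiffOn) hGK hGu hy (m := n) (κ := κ)
  have hD : ∀ y ∈ s, G y *ᵥ deriv u y = ![0, k 0 y, 0, 0] := fun y hy => by
    have := key 1 (fun l i => iteratedDeriv i (k l) y) hy (fun _ _ _ => rfl) 1 0 le_rfl
    rw [iteratedDeriv_zero, iteratedDeriv_one] at this
    rw [this]
    ext i
    fin_cases i <;> simp [frenetJet, KLbasis, KL, Fin.sum_univ_three]
  -- `k₀` may be negative here: all that is needed is `⟨u',u'⟩ = k₀² > 0`.
  let t : Set ℝ := s ∩ {y | u y 3 ≠ 0} ∩ {y | k 0 y ≠ 0}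
  have hto : IsOpen t := ((continuousOn_pi.1 huc.continuousOn 3).isOpen_inter_preimage hso
    isOpen_compl_singleton).inter (isOpen_compl_singleton.preimage (hk 0).continuous)
  have hcone : ∀ y ∈ s, ip (u y) (u y) = 0 := fun y hy => by
    rw [← ip_mulVec (hO y hy), hGu y hy, ip_eq]
    simp
  have hst : IsStarShaped u t := by
    refine ⟨hto, huc.mono fun y hy => hy.1.1, fun y hy => hcone y hy.1.1, fun y hy => hy.1.2,
      fun y hy => IsTangentPair.notMem_span ⟨hy.1.2, hcone y hy.1.1, ?_, ?_⟩⟩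
    · rw [← ip_mulVec (hO y hy.1.1), hGu y hy.1.1, hD y hy.1.1, ip_eq]
      simp
    · rw [← ip_mulVec (hO y hy.1.1), hD y hy.1.1, ip_eq]
      have : k 0 y ≠ 0 := hy.2
      simpa using mul_self_pos.2 this
  refine ⟨u, t, x, hst, ⟨⟨hx, by simp [hux]⟩, ?_⟩, Prod.ext rfl (funext fun r => ?_)⟩
  · have := hκ 0 0 (Nat.zero_le _)
    simp only [iteratedDeriv_zero] at this
    change k 0 x ≠ 0
    rw [← this]
    simpa [extendJet] using h0
  · have := key m (extendJet κ) hx (fun l i hi => hκ l i hi) r 0 (by omega)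
    simpa [hGx, jet] using this

/-! ### Generation of all differential invariants -/

/-- Invariantization: the jet of a curve in its frame is determined by the jet of the invariants. -/
theorem act_coneFrame_jet {u : ℝ → V} {s : Set ℝ} (h : IsStarShaped u s) {x : ℝ} (hx : x ∈ s)
    (m : ℕ) : act (coneFrame (jet 2 u x)) (jet m u x) =
      (x, fun r : Fin (m + 1) => frenetJet (extendJet (genJet m u x).2) r 0) := by
  refine Prod.ext rfl (funext fun r => ?_)
  have hGK : ∀ y ∈ s, ∀ a b, HasDerivAt (fun y => coneFrame (jet 2 u y) a b)
      ((KL (gen 0 (jet 3 u y)) (gen 1 (jet 3 u y)) (gen 2 (jet 3 u y)) *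
        coneFrame (jet 2 u y)) a b) y := fun y hy a b => by
    have hd := (((h.contDiffOn_coneFrame a b).differentiableOn (by simp)).differentiableAt
      (h.isOpen.mem_nhds hy)).hasDerivAt
    refine hd.congr_deriv ?_
    have hT : coneFrame (jet 2 u y) ∈ SO31 := coneFrame_mem (h.isTangentPair hy)
    change _ = (KL (k0 (jet 3 u y)) (k1 (jet 3 u y)) (k2 (jet 3 u y)) * coneFrame (jet 2 u y)) a b
    rw [← h.rightMaurerCartan_coneFrame hy, rightMaurerCartan, Matrix.mul_assoc,
      Matrix.nonsing_inv_mul _ (isUnit_det_of_mem_O31 hT.1), Matrix.mul_one, Matrix.of_apply]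
  have := iteratedDeriv_frame_mulVec h.isOpen h.contDiffOn_coneFrame h.smooth
    (k := fun l y => gen l (jet 3 u y)) h.contDiffOn_gen hGK
    (fun y hy => by
      have := coneFrame_mulVec_zero (j := jet 2 u y) (h.isTangentPair hy)
      simpa [jet] using this) hx (m := m)
    (κ := extendJet (genJet m u x).2)
    (fun l i hi => by simp [extendJet, genJet, Nat.lt_succ_of_le hi]) r 0 (by omega)
  rw [iteratedDeriv_zero] at this
  exact this

theorem exists_generating_function (m : ℕ) (I : Jet m → ℝ)
    (hI : IsDifferentialInvariant SO31 m I) :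
    ∃ F : ℝ × (Fin 3 → Fin (m + 1) → ℝ) → ℝ,
      ∀ (u : ℝ → V) (s : Set ℝ), IsStarShaped u s → ∀ x ∈ s,
        I (jet m u x) = F (genJet m u x) ∧
        (ContDiffWithinAt ℝ ∞ I (coneJets m) (jet m u x) →
          ContDiffAt ℝ ∞ F (genJet m u x)) := by
  let Φ : ℝ × (Fin 3 → Fin (m + 1) → ℝ) → Jet m :=
    fun p => (p.1, fun r => frenetJet (extendJet p.2) r 0)
  have hΦ : ContDiff ℝ ∞ Φ := contDiff_fst.prodMk
    (contDiff_pi.2 fun r => (contDiff_frenetJet m r 0).comp contDiff_snd)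
  -- `F` evaluates `I` on the normalized jet. The normalizing group element comes from the second
  -- jet of the curve even when `m < 2`.
  refine ⟨I ∘ Φ, fun u s h x hx => ?_⟩
  have hj : jet m u x ∈ coneJets m := ⟨u, s, x, h, hx, rfl⟩
  have hρ : coneFrame (jet 2 u x) ∈ SO31 := coneFrame_mem (h.isTangentPair hx)
  have hact : act (coneFrame (jet 2 u x)) (jet m u x) = Φ (genJet m u x) :=
    act_coneFrame_jet h hx m
  have hj' : act (coneFrame (jet 2 u x)) (jet m u x) ∈ coneJets m := by
    refine act_mem_coneJets hj hρ.1 ?_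
    have : coneFrame (jet 2 u x) *ᵥ (jet m u x).2 0 = ![0, 0, 0, 1] :=
      coneFrame_mulVec_zero (j := jet 2 u x) (h.isTangentPair hx)
    simp [this]
  refine ⟨by rw [Function.comp_apply, ← hact, hI _ hρ _ hj hj'], fun hs => ?_⟩
  have hs' := contDiffWithinAt_act hI hρ (by simpa [jet] using h.coord_ne_zero x hx) hj' hs
  rw [hact] at hs'
  -- An open set that `Φ` maps into the jets of cone curves; it upgrades smoothness of `I` relative
  -- to those jets to smoothness of `F` in a full neighbourhood.
  set N : Set (ℝ × (Fin 3 → Fin (m + 1) → ℝ)) := {p | p.2 0 0 ≠ 0}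
  have hN : IsOpen N := isOpen_compl_singleton.preimage (by fun_prop :
    Continuous fun p : ℝ × (Fin 3 → Fin (m + 1) → ℝ) => p.2 0 0)
  have hxN : genJet m u x ∈ N := by
    have := (h.isTangentPair hx).normJ_pos.ne'
    simpa [N, genJet, gen, k0, jet] using this
  have := hs'.comp (genJet m u x) hΦ.contDiffWithinAt
    (s := N) (fun p hp => frenetJet_mem_coneJets p.1 p.2 hp)
  exact this.contDiffAt (hN.mem_nhds hxN)

end LightCone

end

theorem mainTheorem1 :
    -- `ρ_L` is the element of `SO(3,1)` determined by the normalization equations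
    (∀ j ∈ LightCone.coneJets 2, ∀ g : LightCone.Mat4,
      (g ∈ LightCone.SO31 ∧
        g *ᵥ j.2 0 = ![0, 0, 0, 1] ∧
        g *ᵥ j.2 1 = ![0, LightCone.normJ (j.2 1), 0, 0] ∧
        (g *ᵥ j.2 2) 2 = 0) ↔ g = LightCone.coneFrame j) ∧
    -- it is a right moving frame
    LightCone.IsRightMovingFrame LightCone.SO31 2 LightCone.coneFrame ∧
    -- its Maurer–Cartan matrix along star-shaped curves is `K_L`
    (∀ (u : ℝ → LightCone.V) (s : Set ℝ), LightCone.IsStarShaped u s → ∀ x ∈ s,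
      (∀ a b, DifferentiableAt ℝ (fun y => LightCone.coneFrame (LightCone.jet 2 u y) a b) x) ∧
      LightCone.rightMaurerCartan (fun y => LightCone.coneFrame (LightCone.jet 2 u y)) x =
        LightCone.KL (LightCone.k0 (LightCone.jet 3 u x)) (LightCone.k1 (LightCone.jet 3 u x))
          (LightCone.k2 (LightCone.jet 3 u x))) ∧
    -- `k₀`, `k₁`, `k₂` are differential invariants, `k₂` up to the sign `det Θ`
    LightCone.IsDifferentialInvariant LightCone.O31 3 LightCone.k0 ∧
    LightCone.IsDifferentialInvariant LightCone.O31 3 LightCone.k1 ∧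
    LightCone.IsDifferentialInvariant LightCone.SO31 3 LightCone.k2 ∧
    (∀ Θ ∈ LightCone.O31, ∀ j ∈ LightCone.coneJets 3, LightCone.act Θ j ∈ LightCone.coneJets 3 →
      LightCone.k2 (LightCone.act Θ j) = Θ.det * LightCone.k2 j) ∧
    -- together with their derivatives they generate all differential invariants
    (∀ (m : ℕ) (I : LightCone.Jet m → ℝ),
      LightCone.IsDifferentialInvariant LightCone.SO31 m I →
      ∃ F : ℝ × (Fin 3 → Fin (m + 1) → ℝ) → ℝ,
        ∀ (u : ℝ → LightCone.V) (s : Set ℝ), LightCone.IsStarShaped u s → ∀ x ∈ s,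
          I (LightCone.jet m u x) = F (LightCone.genJet m u x) ∧
          (ContDiffWithinAt ℝ ∞ I (LightCone.coneJets m) (LightCone.jet m u x) →
            ContDiffAt ℝ ∞ F (LightCone.genJet m u x))) := by
  exact ⟨fun j hj => LightCone.normalized_iff (LightCone.isTangentPair_of_mem_coneJets hj)
      (LightCone.ip_zero_two_of_mem_coneJets hj),
    LightCone.coneFrame_isRightMovingFrame,
    fun u s h x hx => ⟨fun a b => ((h.contDiffOn_coneFrame a b).differentiableOn
      (by simp)).differentiableAt (h.isOpen.mem_nhds hx), h.rightMaurerCartan_coneFrame hx⟩,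
    LightCone.k0_invariant, LightCone.k1_invariant,
    fun Θ hΘ j hj hj' => by rw [LightCone.k2_act hΘ.1 hj hj', hΘ.2, one_mul],
    fun Θ hΘ j hj hj' => LightCone.k2_act hΘ hj hj',
    LightCone.exists_generating_function⟩
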